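/- Let $\Lambda=\mathbb Z^3$ and let $\Lambda^\vee=\mathrm{Hom}(\Lambda,\mathbb Z)$; for $\delta\in\Lambda^\vee\otimes\mathbb Q$ write $\delta(x)$ also for its complex-linear extension to $x\in\mathbb C^3$. A vector $a\in\Lambda$ is primitive if $a\in k\Lambda$, $k\in\mathbb Z$, implies $k=\pm1$ (and likewise in $\Lambda^\vee$). For primitive $a$, let $H(a)=\{\alpha\in\Lambda^\vee\otimes\mathbb Q : \alpha(a)=0\}$, where a basis $\alpha,\beta$ of $H(a)$ is called oriented if $\det(\alpha,\beta,\delta)>0$ whenever $\delta(a)>0$. Let $U_a^+\subset\mathbb C^3$ be the set of $x$ such that $\mathrm{Im}\big(\alpha(x)\overline{\beta(x)}\big)>0$ for some oriented basis $\alpha,\beta$ of $H(a)$. For linearly independent primitive $a,b\in\Lambda$ let $\gamma=\gamma_{a,b}\in\Lambda^\vee$ be the unique primitive form such that $\det(a,b,\cdot)=s\gamma$ with an integer $s>0$, let $C_{+-}(a,b)=\{\delta\in\Lambda^\vee:\delta(a)>0,\ \delta(b)\le0\}$ and $C_{-+}(a,b)=\{\delta\in\Lambda^\vee:\delta(a)\le0,\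 \delta(b)>0\}$, and set, for $w\in\mathbb C$ and $x\in U_a^+\cap U_b^+$, $$\Gamma_{a,b}(w,x)=\frac{\prod_{\delta\in C_{+-}(a,b)/\mathbb Z\gamma}\big(1-e^{-2\pi i(\delta(x)-w)/\gamma(x)}\big)}{\prod_{\delta\in C_{-+}(a,b)/\mathbb Z\gamma}\big(1-e^{2\pi i(\delta(x)-w)/\gamma(x)}\big)}.$$ Set $\Gamma_{a,a}=1$. (If $b=-a$, then $U_a^+\cap U_b^+=\emptyset$ and $\Gamma_{a,b}$ is not needed.) Let $Z_{a,b}(x)=\{\delta(x):\delta\in C_{+-}(a,b)\cup C_{-+}(a,b)\}\subset\mathbb C$. **Theorem.** (1) Let $a,b\in\Lambda$ be primitive and $x\in U_a^+\cap U_b^+$. The infinite products in the definition of $\Gamma_{a,b}(w,x)$ converge unconditionally for all $w\in\mathbb C$, $\Gamma_{a,b}(\cdot,x)$ is meromorphic on $\mathbb C$, and $Z_{a,b}(x)$ is a closed discrete subset of $\mathbb C$. Moreover, as an identity of meromorphic functions of $w$, $$\Gamma_{a,b}(w,x)\,\Gamma_{b,a}(w,x)=1,$$ and it holds pointwise for all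 $w\notin Z_{a,b}(x)$. (2) Let $a,b,c\in\Lambda$ be primitive. There is a polynomial $P_{a,b,c}\in\mathbb Q(x_1,x_2,x_3)[w]$, of degree at most $3$ in $w$, such that for every $x\in U_a^+\cap U_b^+\cap U_c^+$ its coefficients have no pole at $x$ and, as an identity of meromorphic functions of $w$, $$\Gamma_{a,b}(w,x)\,\Gamma_{b,c}(w,x)\,\Gamma_{c,a}(w,x)=\exp\Big(-\frac{\pi i}{3}P_{a,b,c}(w,x)\Big),$$ which holds pointwise for all $w\notin Z_{a,b}(x)\cup Z_{b,c}(x)\cup Z_{c,a}(x)$. -/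

import Mathlib

noncomputable section

namespace GammaWedge

open scoped Matrix

/-- An element `v` of a `ℤ`-module `M` is primitive if `v ∈ k M` forces `k = ±1`. -/
def IsPrimitive {M : Type*} [AddCommGroup M] (v : M) : Prop :=
  ∀ k : ℤ, (∃ u : M, v = k • u) → k = 1 ∨ k = -1

/-- The value `α(x)` at `x ∈ ℂ³` of the linear form with coordinates `α`
(integral or rational) in the basis dual to the standard one. -/
def formEval {R : Type*} [CommRing R] [Algebra R ℂ] (α : Fin 3 → R) (x : Fin 3 → ℂ) : ℂ :=
  ∑ i, algebraMap R ℂ (α i) * x i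

/-- `α, β` is an oriented basis of the rational plane `H(a) = {α | α(a) = 0}`, where `H(a)` is
oriented so that `det(α, β, δ) > 0` whenever `δ(a) > 0`. -/
def IsOrientedBasis (a : Fin 3 → ℤ) (α β : Fin 3 → ℚ) : Prop :=
  α ⬝ᵥ (fun i => (a i : ℚ)) = 0 ∧ β ⬝ᵥ (fun i => (a i : ℚ)) = 0 ∧
  LinearIndependent ℚ ![α, β] ∧
  ∀ δ : Fin 3 → ℚ, 0 < δ ⬝ᵥ (fun i => (a i : ℚ)) → 0 < (Matrix.of ![α, β, δ]).det

/-- The domain `U_a^+ ⊆ ℂ³`: points `x` with `Im (α(x) * conj β(x)) > 0` for some oriented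
basis `α, β` of `H(a)`. -/
def UPlus (a : Fin 3 → ℤ) : Set (Fin 3 → ℂ) :=
  {x | ∃ α β : Fin 3 → ℚ, IsOrientedBasis a α β ∧
    0 < (formEval α x * (starRingEnd ℂ) (formEval β x)).im}

/-- The direction vector of the wedge `(a, b)`: the form `det(a, b, ·)`, whose coordinates are
those of the cross product, divided by the greatest common divisor of its coordinates. -/
def directionVector (a b : Fin 3 → ℤ) : Fin 3 → ℤ :=
  fun i => (a ⨯₃ b) i / Finset.univ.gcd (a ⨯₃ b)

lemma det_eq_cross (a b y : Fin 3 → ℤ) : (Matrix.of ![a, b, y]).det = (a ⨯₃ b) ⬝ᵥ y := by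
  rw [Matrix.det_fin_three]
  simp [cross_apply, dotProduct, Fin.sum_univ_three]
  ring

lemma cross_ne_zero (a b : Fin 3 → ℤ) (h : LinearIndependent ℤ ![a, b]) : a ⨯₃ b ≠ 0 := by
  intro h0
  have e0 := congrFun h0 0
  have e1 := congrFun h0 1
  have e2 := congrFun h0 2
  simp only [cross_apply, Matrix.cons_val, Pi.zero_apply] at e0 e1 e2
  rw [LinearIndependent.pair_iff] at h
  have hz : ∀ i, a i = 0 := by
    intro i
    have hi : b i • a + (-a i) • b = 0 := by
      funext j
      simp only [Pi.add_apply, Pi.smul_apply, smul_eq_mul, Pi.zero_apply]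
      fin_cases i <;> fin_cases j <;> simp <;> linarith
    simpa using (h _ _ hi).2
  have h1 := (h 1 0 (by funext j; simp [hz j])).1
  exact one_ne_zero h1

/-- For linearly independent `a, b`, the direction vector is a primitive form (hence the only
one) of which `det(a, b, ·)` is a positive integer multiple. -/
theorem directionVector_spec (a b : Fin 3 → ℤ) (h : LinearIndependent ℤ ![a, b]) :
    IsPrimitive (directionVector a b) ∧ ∃ s : ℤ, 0 < s ∧
      ∀ y : Fin 3 → ℤ, (Matrix.of ![a, b, y]).det = s * (directionVector a b ⬝ᵥ y) := by
  set g : ℤ := Finset.univ.gcd (a ⨯₃ b) with hg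
  have hne : (a ⨯₃ b) ≠ 0 := cross_ne_zero a b h
  have hg0 : g ≠ 0 := by
    intro h0
    apply hne
    funext i
    exact Finset.gcd_eq_zero_iff.mp h0 i (Finset.mem_univ i)
  have hgpos : 0 < g := 
    lt_of_le_of_ne (Int.nonneg_of_normalize_eq_self Finset.normalize_gcd) (Ne.symm hg0)
  have hmul : ∀ i, (a ⨯₃ b) i = g * directionVector a b i := fun i =>
    (Int.mul_ediv_cancel' (Finset.gcd_dvd (Finset.mem_univ i))).symm
  refine ⟨?_, g, hgpos, ?_⟩
  · rintro k ⟨u, hu⟩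
    have hd : g * k ∣ g := by
      apply Finset.dvd_gcd
      intro i _
      rw [hmul i, hu]
      exact ⟨u i, by simp [mul_assoc]⟩
    have hk : k ∣ 1 := by
      rw [← mul_dvd_mul_iff_left hg0, mul_one]
      exact hd
    exact Int.isUnit_iff.mp (isUnit_of_dvd_one hk)
  · intro y
    rw [det_eq_cross]
    simp only [dotProduct, Finset.mul_sum]
    exact Finset.sum_congr rfl fun i _ => by rw [hmul i, mul_assoc]

/-- The set `C_{+-}(a, b)` of integral forms `δ` with `δ(a) > 0` and `δ(b) ≤ 0`.
Note that `C_{-+}(a, b) = C_{+-}(b, a)`. -/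
def cone (a b : Fin 3 → ℤ) : Set (Fin 3 → ℤ) := {δ | 0 < δ ⬝ᵥ a ∧ δ ⬝ᵥ b ≤ 0}

/-- The quotient of a set `C` of forms by the translations by integer multiples of `γ`, realised
as the image of `C` in `ℤ³ / ℤγ`. -/
def orbits (C : Set (Fin 3 → ℤ)) (γ : Fin 3 → ℤ) :
    Set ((Fin 3 → ℤ) ⧸ AddSubgroup.zmultiples γ) :=
  (fun δ => (QuotientAddGroup.mk δ : (Fin 3 → ℤ) ⧸ AddSubgroup.zmultiples γ)) '' C

lemma factor_invariant (ε : ℤ) (γ δ δ' : Fin 3 → ℤ) (w : ℂ) (x : Fin 3 → ℂ)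
    (h : QuotientAddGroup.leftRel (AddSubgroup.zmultiples γ) δ δ') :
    1 - Complex.exp (ε * (2 * Real.pi * Complex.I) * (formEval δ x - w) / formEval γ x) =
    1 - Complex.exp (ε * (2 * Real.pi * Complex.I) * (formEval δ' x - w) / formEval γ x) := by
  rw [QuotientAddGroup.leftRel_apply, AddSubgroup.mem_zmultiples_iff] at h
  obtain ⟨n, hn⟩ := h
  have hδ : formEval δ' x = formEval δ x + n * formEval γ x := by
    have : δ' = δ + n • γ := by rw [hn]; abel
    subst this
    simp only [formEval, Pi.add_apply, Pi.smul_apply, smul_eq_mul, map_add, map_mul, add_mul,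
      Finset.sum_add_distrib, Finset.mul_sum, mul_assoc]
    simp
  by_cases hγ : formEval γ x = 0
  · simp [hγ]
  · congr 1
    rw [Complex.exp_eq_exp_iff_exists_int]
    refine ⟨-(ε * n), ?_⟩
    rw [hδ]
    push_cast
    field_simp
    ring

/-- The factor `1 - exp(ε 2πi (δ(x) - w) / γ(x))` attached to the class of `δ` modulo `ℤγ`. -/
def factor (ε : ℤ) (γ : Fin 3 → ℤ) (w : ℂ) (x : Fin 3 → ℂ)
    (q : (Fin 3 → ℤ) ⧸ AddSubgroup.zmultiples γ) : ℂ :=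
  Quotient.liftOn q
    (fun δ => 1 - Complex.exp
      (ε * (2 * Real.pi * Complex.I) * (formEval δ x - w) / formEval γ x))
    (fun δ δ' h => factor_invariant ε γ δ δ' w x h)

/-- The factors of the numerator of `Γ_{a,b}`, indexed by `C_{+-}(a, b) / ℤγ`. -/
def numFactor (a b : Fin 3 → ℤ) (w : ℂ) (x : Fin 3 → ℂ)
    (q : orbits (cone a b) (directionVector a b)) : ℂ :=
  factor (-1) (directionVector a b) w x q

/-- The factors of the denominator of `Γ_{a,b}`, indexed by `C_{-+}(a, b) / ℤγ`. -/
def denFactor (a b : Fin 3 → ℤ) (w : ℂ) (x : Fin 3 → ℂ)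
    (q : orbits (cone b a) (directionVector a b)) : ℂ :=
  factor 1 (directionVector a b) w x q

open scoped Classical in
/-- The gamma function `Γ_{a,b}(w, x)` of the wedge `(a, b)`; it is used only for
`x ∈ U_a^+ ∩ U_b^+`, a set that is empty if `b = -a`. -/
def Gam (a b : Fin 3 → ℤ) (w : ℂ) (x : Fin 3 → ℂ) : ℂ :=
  if a = b then 1 else (∏' q, numFactor a b w x q) / (∏' q, denFactor a b w x q)

/-- The set of zeros and poles in `w` of `Γ_{a,b}(·, x)`, that is, the set of points `δ(x)` with
`δ ∈ C_{+-}(a, b) ∪ C_{-+}(a, b)` (this union is stable under translation by `ℤγ`). -/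
def zerosPoles (a b : Fin 3 → ℤ) (x : Fin 3 → ℂ) : Set ℂ :=
  {w | ∃ δ ∈ cone a b ∪ cone b a, w = formEval δ x}

/-- The field `ℚ(x₁, x₂, x₃)` of rational functions. -/
abbrev RatFun : Type := FractionRing (MvPolynomial (Fin 3) ℚ)

/-- The rational function `f` (in lowest terms) has no pole at `x`. -/
def RatFun.RegularAt (f : RatFun) (x : Fin 3 → ℂ) : Prop :=
  MvPolynomial.aeval x (IsFractionRing.den (MvPolynomial (Fin 3) ℚ) f : MvPolynomial (Fin 3) ℚ) ≠ 0

/-- The value of the rational function `f` at `x`, meaningful where `f` is regular. -/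
def RatFun.value (f : RatFun) (x : Fin 3 → ℂ) : ℂ :=
  MvPolynomial.aeval x (IsFractionRing.num (MvPolynomial (Fin 3) ℚ) f) /
    MvPolynomial.aeval x
      (IsFractionRing.den (MvPolynomial (Fin 3) ℚ) f : MvPolynomial (Fin 3) ℚ)

/-- The value `P(w, x)` of a polynomial `P ∈ ℚ(x₁, x₂, x₃)[w]`. -/
def polyValue (P : Polynomial RatFun) (w : ℂ) (x : Fin 3 → ℂ) : ℂ :=
  P.sum fun k f => RatFun.value f x * w ^ k

end GammaWedge

end

noncomputable section

/-!
Modulo the direction vector `γ`, the cone of a wedge splits into the translates, by a quadrant of a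
lattice of rank two, of the integral points `δ` of a parallelepiped. For a positively oriented
triple the same parallelepiped serves all three wedges. For fixed `δ` and `w` near `0`, put
`z = w - δ(x)`: the logarithms of the corresponding factors of the three functions `Γ` sum up to
`2πi` times the residues of the Barnes kernel `exp (t z) / (t ∏ (1 - exp (-t oₖ)))` at its nonzero
poles, where the periods `oₖ` are the values at `x` of the three direction vectors. The residue
theorem evaluates the total by the residue at the origin, a triple Bernoulli polynomial, which is
cubic in `z`. Analytic continuation in `w` extends the identity to the whole plane. Exchanging two
of the vectors inverts every `Γ`, which settles negatively oriented triples. For a coplanar triple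
one cone is the disjoint union of the other two, and the exponent is `0`.
-/

namespace GammaWedge

section Residue

open Filter Topology Metric

variable {f : ℂ → ℂ} {c s : ℂ} {R : ℝ}

theorem circleIntegral_eq_zero_of_tendsto (hR : 0 < R) (S : Finset ℂ) (hS : (S : Set ℂ) ⊆ ball c R)
    (hf : ∀ t ∈ closedBall c R, t ∉ S → DifferentiableAt ℂ f t)
    (hlim : ∀ s ∈ S, ∃ L, Tendsto f (𝓝[≠] s) (𝓝 L)) :
    (∮ t in C(c, R), f t) = 0 := by
  classical
  set g : ℂ → ℂ := fun t => if t ∈ S then limUnder (𝓝[≠] t) f else f t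
  have g_eq : ∀ t ∉ S, g t = f t := fun t ht => if_neg ht
  have eventually_notMem : ∀ t, ∀ᶠ u in 𝓝[≠] t, u ∉ S := by
    intro t
    have : ((S.erase t : Finset ℂ) : Set ℂ)ᶜ ∈ 𝓝 t :=
      (S.erase t).finite_toSet.isClosed.isOpen_compl.mem_nhds (by simp)
    filter_upwards [nhdsWithin_le_nhds this, self_mem_nhdsWithin] with u hu hut huS
    exact hu (Finset.mem_coe.2 (Finset.mem_erase.2 ⟨hut, huS⟩))
  have g_diff : ∀ t ∈ closedBall c R, t ∉ S → DifferentiableAt ℂ g t := fun t ht htS =>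
    (hf t ht htS).congr_of_eventuallyEq <|
      (S.finite_toSet.isClosed.isOpen_compl.eventually_mem htS).mono g_eq
  have g_cont : ContinuousOn g (closedBall c R) := by
    intro t ht
    by_cases htS : t ∈ S
    · refine (continuousAt_iff_punctured_nhds.2 ?_).continuousWithinAt
      rw [show g t = limUnder (𝓝[≠] t) f from if_pos htS]
      exact (tendsto_nhds_limUnder (hlim t htS)).congr'
        ((eventually_notMem t).mono fun u hu => (g_eq u hu).symm)
    · exact (g_diff t ht htS).continuousAt.continuousWithinAt
  have sphere_notMem : ∀ t ∈ sphere c R, t ∉ S := fun t ht htS =>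
    (mem_ball.1 (hS htS)).ne (mem_sphere.1 ht)
  rw [← circleIntegral.integral_congr hR.le fun t ht => g_eq t (sphere_notMem t ht)]
  exact Complex.circleIntegral_eq_zero_of_differentiable_on_off_countable hR.le
    S.countable_toSet g_cont fun t ht => g_diff t (ball_subset_closedBall ht.1) ht.2

/-- `f` has residue `r` at `s`, where it is regular or has a pole. The principal part is encoded as
a polynomial in `(t - s)⁻¹` without constant term, written `(t - s)⁻¹ * p((t - s)⁻¹)`, so that the
residue is the constant coefficient of `p`. -/
def HasResidueAt (f : ℂ → ℂ) (s r : ℂ) : Prop :=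
  ∃ p : Polynomial ℂ, p.coeff 0 = r ∧
    ∃ L, Tendsto (fun t => f t - (t - s)⁻¹ * p.eval (t - s)⁻¹) (𝓝[≠] s) (𝓝 L)

theorem differentiableAt_principalPart (p : Polynomial ℂ) {t : ℂ} (ht : t ≠ s) :
    DifferentiableAt ℂ (fun t => (t - s)⁻¹ * p.eval (t - s)⁻¹) t := by
  have hts : t - s ≠ 0 := sub_ne_zero.2 ht
  have hinv : DifferentiableAt ℂ (fun t => (t - s)⁻¹) t := by fun_prop (disch := exact hts)
  exact hinv.mul (p.differentiable.differentiableAt.comp t hinv)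

theorem circleIntegrable_of_differentiableAt (hR : 0 ≤ R)
    (hf : ∀ t ∈ sphere c R, DifferentiableAt ℂ f t) : CircleIntegrable f c R :=
  ContinuousOn.circleIntegrable hR fun t ht => (hf t ht).continuousAt.continuousWithinAt

theorem circleIntegral_principalPart (p : Polynomial ℂ) (hs : s ∈ ball c R) :
    (∮ t in C(c, R), (t - s)⁻¹ * p.eval (t - s)⁻¹) = 2 * Real.pi * Complex.I * p.coeff 0 := by
  have hR : 0 < R := dist_nonneg.trans_lt hs
  have ne_of_sphere : ∀ t ∈ sphere c R, t ≠ s := by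
    rintro t ht rfl
    exact (mem_ball.1 hs).ne (mem_sphere.1 ht)
  induction p using Polynomial.induction_on' with
  | add p q hp hq =>
    have integrable (p : Polynomial ℂ) :=
      circleIntegrable_of_differentiableAt hR.le fun t ht =>
        differentiableAt_principalPart p (ne_of_sphere t ht)
    simp only [Polynomial.eval_add, mul_add, Polynomial.coeff_add]
    rw [circleIntegral.integral_add (integrable p) (integrable q), hp, hq]
  | monomial n a =>
    have eval_eq (t : ℂ) : (t - s)⁻¹ * (Polynomial.monomial n a).eval (t - s)⁻¹ =
        a * (t - s) ^ (-(n + 1 : ℤ)) := by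
      rw [Polynomial.eval_monomial, zpow_neg, ← Nat.cast_succ, zpow_natCast, pow_succ, mul_inv,
        inv_pow]
      ring
    simp only [eval_eq, circleIntegral.integral_const_mul, Polynomial.coeff_monomial]
    rcases n with _ | n
    · simp only [CharP.cast_eq_zero, zero_add, zpow_neg_one, ↓reduceIte]
      rw [circleIntegral.integral_sub_inv_of_mem_ball hs, mul_comm]
    · rw [circleIntegral.integral_sub_zpow_of_ne (by omega)]
      simp

theorem circleIntegral_eq_sum_residues {ι : Type*} (T : Finset ι) {s r : ι → ℂ} (hR : 0 < R)
    (hs : ∀ i ∈ T, s i ∈ ball c R) (hinj : Set.InjOn s T)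
    (hf : ∀ t ∈ closedBall c R, (∀ i ∈ T, t ≠ s i) → DifferentiableAt ℂ f t)
    (hr : ∀ i ∈ T, HasResidueAt f (s i) (r i)) :
    (∮ t in C(c, R), f t) = 2 * Real.pi * Complex.I * ∑ i ∈ T, r i := by
  classical
  choose! p hpr L hL using hr
  set P : ι → ℂ → ℂ := fun i t => (t - s i)⁻¹ * (p i).eval (t - s i)⁻¹
  have ne_of_notMem : ∀ t ∉ T.image s, ∀ i ∈ T, t ≠ s i := fun t ht i hi h =>
    ht (Finset.mem_image.2 ⟨i, hi, h.symm⟩)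
  have remainder : (∮ t in C(c, R), (f t - ∑ i ∈ T, P i t)) = 0 := by
    refine circleIntegral_eq_zero_of_tendsto hR (T.image s) ?_ (fun t ht htS => ?_) fun t ht => ?_
    · simpa [Set.subset_def] using hs
    · exact (hf t ht (ne_of_notMem t htS)).sub (DifferentiableAt.fun_sum fun i hi =>
        differentiableAt_principalPart _ (ne_of_notMem t htS i hi))
    · obtain ⟨i, hi, rfl⟩ := Finset.mem_image.1 ht
      have others : ContinuousAt (fun t => ∑ j ∈ T.erase i, P j t) (s i) :=
        (DifferentiableAt.fun_sum (𝕜 := ℂ) fun j hj => differentiableAt_principalPart _ fun h =>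
          (Finset.ne_of_mem_erase hj) (hinj (Finset.mem_of_mem_erase hj) hi h.symm)).continuousAt
      refine ⟨_, ((hL i hi).sub (others.tendsto.mono_left nhdsWithin_le_nhds)).congr fun t => ?_⟩
      rw [← Finset.add_sum_erase T _ hi, sub_sub]
  have ne_of_sphere : ∀ t ∈ sphere c R, ∀ i ∈ T, t ≠ s i := by
    rintro _ ht i hi rfl
    exact (mem_ball.1 (hs i hi)).ne (mem_sphere.1 ht)
  have integrable : ∀ i ∈ T, CircleIntegrable (P i) c R := fun i hi =>
    circleIntegrable_of_differentiableAt hR.le fun t ht =>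
      differentiableAt_principalPart _ (ne_of_sphere t ht i hi)
  rw [circleIntegral.integral_sub (circleIntegrable_of_differentiableAt hR.le fun t ht =>
      hf t (sphere_subset_closedBall ht) (ne_of_sphere t ht))
      (CircleIntegrable.fun_sum _ integrable),
    circleIntegral.integral_fun_sum integrable, sub_eq_zero] at remainder
  rw [remainder, Finset.mul_sum]
  refine Finset.sum_congr rfl fun i hi => ?_
  rw [circleIntegral_principalPart _ (hs i hi), hpr i hi]

theorem hasResidueAt_div_of_simple_zero {N D : ℂ → ℂ} {D' : ℂ} (hN : DifferentiableAt ℂ N s)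
    (hD : Differentiable ℂ D) (hs : D s = 0) (hD' : HasDerivAt D D' s) (h0 : D' ≠ 0) :
    HasResidueAt (fun t => N t / D t) s (N s / D') := by
  have dslope_self : dslope D s s = D' := by rw [dslope_same, hD'.deriv]
  have hq : DifferentiableAt ℂ (fun t => N t / dslope D s t) s := by
    refine hN.fun_div ?_ (dslope_self ▸ h0)
    exact ((Complex.differentiableOn_dslope univ_mem).2 hD.differentiableOn).differentiableAt
      univ_mem
  refine ⟨Polynomial.C (N s / D'), Polynomial.coeff_C_zero, _,
    (hasDerivAt_iff_tendsto_slope.1 hq.hasDerivAt).congr' ?_⟩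
  filter_upwards [self_mem_nhdsWithin] with t (ht : t ≠ s)
  have hts := sub_ne_zero.2 ht
  rw [slope_def_field, dslope_self, dslope_of_ne _ ht, slope_def_field, hs, sub_zero,
    Polynomial.eval_C]
  field_simp

end Residue

section AsymptoticExpansion

open Filter Topology Asymptotics Complex PowerSeries

/-- `φ` is an asymptotic expansion of `F` at the origin; the value of `F` at the origin itself is
disregarded. -/
def HasExpansion (F : ℂ → ℂ) (φ : PowerSeries ℂ) : Prop :=
  ∀ n, (fun t => F t - (trunc n φ).eval t) =O[𝓝[≠] 0] fun t => t ^ n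

theorem isBigO_one_eval (p : Polynomial ℂ) : p.eval =O[𝓝[≠] (0 : ℂ)] fun _ => (1 : ℂ) :=
  (p.continuous.continuousAt.tendsto.mono_left nhdsWithin_le_nhds).isBigO_one ℂ

theorem isBigO_eval_of_X_pow_dvd {p : Polynomial ℂ} {n : ℕ} (h : Polynomial.X ^ n ∣ p) :
    p.eval =O[𝓝[≠] (0 : ℂ)] fun t => t ^ n := by
  obtain ⟨q, rfl⟩ := h
  simpa using (isBigO_refl (fun t : ℂ => t ^ n) (𝓝[≠] 0)).mul (isBigO_one_eval q)

theorem eval_trunc (φ : PowerSeries ℂ) (n : ℕ) (t : ℂ) :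
    (trunc n φ).eval t = ∑ i ∈ Finset.range n, coeff i φ * t ^ i :=
  eval₂_trunc_eq_sum_range t (RingHom.id ℂ) n φ

theorem X_pow_dvd_trunc_mul_trunc_sub (φ ψ : PowerSeries ℂ) (n : ℕ) :
    Polynomial.X ^ n ∣ trunc n φ * trunc n ψ - trunc n (φ * ψ) := by
  rw [Polynomial.X_pow_dvd_iff]
  intro d hd
  rw [Polynomial.coeff_sub, ← Polynomial.coeff_coe, Polynomial.coe_mul, ← trunc_trunc_mul_trunc,
    coeff_trunc, if_pos hd, sub_self]

namespace HasExpansion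

variable {F G : ℂ → ℂ} {φ ψ : PowerSeries ℂ}

theorem congr (hF : HasExpansion F φ) (h : F =ᶠ[𝓝[≠] 0] G) : HasExpansion G φ := fun n =>
  (hF n).congr' (h.mono fun _ ht => congrArg (· - _) ht) EventuallyEq.rfl

theorem tendsto (hF : HasExpansion F φ) : Tendsto F (𝓝[≠] 0) (𝓝 (constantCoeff φ)) := by
  have h0 : Tendsto (fun t : ℂ => t ^ 1) (𝓝[≠] 0) (𝓝 0) := by
    simp only [pow_one]
    exact (continuousAt_id (x := (0 : ℂ))).tendsto.mono_left nhdsWithin_le_nhds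
  simpa [trunc_one_left] using ((hF 1).trans_tendsto h0).add_const (constantCoeff φ)

theorem isBigO_one (hF : HasExpansion F φ) : F =O[𝓝[≠] 0] fun _ => (1 : ℂ) :=
  hF.tendsto.isBigO_one ℂ

theorem mul (hF : HasExpansion F φ) (hG : HasExpansion G ψ) :
    HasExpansion (fun t => F t * G t) (φ * ψ) := by
  intro n
  have left := (hF n).mul hG.isBigO_one
  have right := (isBigO_one_eval (trunc n φ)).mul (hG n)
  simp only [mul_one, one_mul] at left right
  refine ((left.add right).add
    (isBigO_eval_of_X_pow_dvd (X_pow_dvd_trunc_mul_trunc_sub φ ψ n))).congr_left fun t => ?_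
  rw [Polynomial.eval_sub, Polynomial.eval_mul]
  ring

theorem sub (hF : HasExpansion F φ) (hG : HasExpansion G ψ) :
    HasExpansion (fun t => F t - G t) (φ - ψ) := fun n =>
  ((hF n).sub (hG n)).congr_left fun t => by
    rw [trunc_sub, Polynomial.eval_sub]
    ring

theorem one : HasExpansion (fun _ => 1) 1
  | 0 => by simpa using isBigO_one_eval 1
  | n + 1 => by simpa using isBigO_zero _ _

theorem prod {ι : Type*} (s : Finset ι) {F : ι → ℂ → ℂ} {φ : ι → PowerSeries ℂ}
    (h : ∀ i, HasExpansion (F i) (φ i)) :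
    HasExpansion (fun t => ∏ i ∈ s, F i t) (∏ i ∈ s, φ i) := by
  classical
  induction s using Finset.induction_on with
  | empty => simpa using one
  | insert i s his ih => simpa only [Finset.prod_insert his] using (h i).mul ih

theorem inv (hF : HasExpansion F φ) (h : φ * ψ = 1) : HasExpansion (fun t => (F t)⁻¹) ψ := by
  have hφ : constantCoeff φ ≠ 0 := fun h0 => by
    simpa [h0] using congrArg constantCoeff h
  rintro (_ | n)
  · simpa using hF.tendsto.inv₀ hφ |>.isBigO_one ℂ
  have product : (fun t => F t * (trunc (n + 1) ψ).eval t - 1) =O[𝓝[≠] 0] fun t => t ^ (n + 1) := by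
    have remainder := (hF (n + 1)).mul (isBigO_one_eval (trunc (n + 1) ψ))
    have truncation := isBigO_eval_of_X_pow_dvd (X_pow_dvd_trunc_mul_trunc_sub φ ψ (n + 1))
    rw [h, trunc_one] at truncation
    simp only [mul_one] at remainder
    refine (remainder.add truncation).congr_left fun t => ?_
    rw [Polynomial.eval_sub, Polynomial.eval_mul, Polynomial.eval_one]
    ring
  have quotient := ((hF.tendsto.inv₀ hφ).isBigO_one ℂ).mul product.neg_left
  simp only [one_mul] at quotient
  refine quotient.congr' ?_ EventuallyEq.rfl
  filter_upwards [hF.tendsto.eventually_ne hφ] with t ht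
  field_simp
  ring

theorem of_mul_X (hF : HasExpansion (fun t => t * F t) (X * φ)) : HasExpansion F φ := by
  intro n
  have trunc_X_mul : trunc (n + 1) (X * φ) = Polynomial.X * trunc n φ := by
    ext (_ | d) <;> simp [coeff_trunc]
  refine ((isBigO_refl (fun t : ℂ => t⁻¹) (𝓝[≠] 0)).mul (hF (n + 1))).congr' ?_ ?_ <;>
    filter_upwards [self_mem_nhdsWithin] with t (ht : t ≠ 0)
  · rw [trunc_X_mul, Polynomial.eval_mul, Polynomial.eval_X]
    field_simp
  · rw [pow_succ']
    field_simp

theorem hasResidueAt {f : ℂ → ℂ} {n : ℕ} (h : HasExpansion (fun t => t ^ (n + 1) * f t) φ) :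
    HasResidueAt f 0 (coeff n φ) := by
  refine ⟨∑ i ∈ Finset.range (n + 1), Polynomial.monomial (n - i) (coeff i φ), ?_, ?_⟩
  · rw [Polynomial.finsetSum_coeff, Finset.sum_eq_single_of_mem n (by simp)]
    · simp
    · intro i hi hin
      rw [Polynomial.coeff_monomial, if_neg]
      have := Finset.mem_range.1 hi
      omega
  · have remainder := (isBigO_refl (fun t : ℂ => (t ^ (n + 1))⁻¹) (𝓝[≠] 0)).mul (h (n + 2))
    have h0 : Tendsto (fun t : ℂ => (t ^ (n + 1))⁻¹ * t ^ (n + 2)) (𝓝[≠] 0) (𝓝 0) := by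
      refine ((tendsto_id (α := ℂ) (x := 𝓝 0)).mono_left nhdsWithin_le_nhds).congr' ?_
      filter_upwards [self_mem_nhdsWithin] with t (ht : t ≠ 0)
      rw [id, pow_succ t (n + 1)]
      field_simp
    refine ⟨_, ((remainder.trans_tendsto h0).add_const (coeff (n + 1) φ)).congr' ?_⟩
    filter_upwards [self_mem_nhdsWithin] with t (ht : t ≠ 0)
    have principal : t⁻¹ * ∑ i ∈ Finset.range (n + 1), coeff i φ * t⁻¹ ^ (n - i) =
        (t ^ (n + 1))⁻¹ * ∑ i ∈ Finset.range (n + 1), coeff i φ * t ^ i := by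
      rw [Finset.mul_sum, Finset.mul_sum]
      refine Finset.sum_congr rfl fun i hi => ?_
      obtain ⟨k, rfl⟩ := Nat.exists_eq_add_of_le (Finset.mem_range_succ_iff.1 hi)
      rw [Nat.add_sub_cancel_left, pow_succ, pow_add, inv_pow]
      field_simp
    rw [eval_trunc, Finset.sum_range_succ, sub_zero, Polynomial.eval_finsetSum]
    simp only [Polynomial.eval_monomial, principal]
    field_simp
    ring

end HasExpansion

theorem hasExpansion_exp_mul (z : ℂ) :
    HasExpansion (fun t => Complex.exp (t * z)) (rescale z (PowerSeries.exp ℂ)) := by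
  intro n
  have h0 : Tendsto (fun t : ℂ => t * z) (𝓝[≠] 0) (𝓝 0) := by
    have : ContinuousAt (fun t : ℂ => t * z) 0 := by fun_prop
    simpa [ContinuousAt] using this.tendsto.mono_left nhdsWithin_le_nhds
  have h1 : (fun t : ℂ => (t * z) ^ n) =O[𝓝[≠] 0] fun t => t ^ n := by
    simpa only [mul_pow, mul_comm] using
      (isBigO_refl (fun t : ℂ => t ^ n) (𝓝[≠] 0)).const_mul_left (z ^ n)
  refine (((Complex.exp_sub_sum_range_isBigO_pow n).comp_tendsto h0).trans h1).congr_left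
    fun t => ?_
  simp only [Function.comp_apply, eval_trunc, coeff_rescale, coeff_exp]
  congr 1
  refine Finset.sum_congr rfl fun i _ => ?_
  simp only [map_div₀, map_one, map_natCast]
  ring

/-- The Todd series `∑ B'ₙ ωⁿ⁻¹ tⁿ / n!`, the expansion of `t / (1 - exp (-(t * ω)))`. -/
def toddSeries (ω : ℂ) : PowerSeries ℂ :=
  C ω⁻¹ * rescale ω (bernoulli'PowerSeries ℂ)

theorem one_sub_rescale_exp_mul_toddSeries {ω : ℂ} (hω : ω ≠ 0) :
    (1 - rescale (-ω) (PowerSeries.exp ℂ)) * toddSeries ω = X := by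
  have bernoulli := congrArg (rescale ω) (bernoulli'PowerSeries_mul_exp_sub_one ℂ)
  have exp_neg : rescale (-ω) (PowerSeries.exp ℂ) * rescale ω (PowerSeries.exp ℂ) = 1 := by
    have := congrArg (rescale ω) (exp_mul_exp_neg_eq_one (A := ℂ))
    simpa [evalNegHom, rescale_rescale, mul_comm] using this
  have inv : C ω⁻¹ * C ω = (1 : PowerSeries ℂ) := by rw [← map_mul, inv_mul_cancel₀ hω, map_one]
  simp only [map_mul, map_sub, map_one, rescale_X] at bernoulli
  rw [toddSeries]
  linear_combination C ω⁻¹ * rescale (-ω) (PowerSeries.exp ℂ) * bernoulli + X * inv -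
    C ω⁻¹ * (rescale ω (bernoulli'PowerSeries ℂ) - C ω * X) * exp_neg

theorem hasExpansion_todd {ω : ℂ} (hω : ω ≠ 0) :
    HasExpansion (fun t => t / (1 - Complex.exp (-(t * ω)))) (toddSeries ω) := by
  obtain ⟨φ, hφ⟩ : X ∣ 1 - rescale (-ω) (PowerSeries.exp ℂ) := by
    rw [X_dvd_iff, map_sub, ← coeff_zero_eq_constantCoeff_apply (rescale _ _), coeff_rescale]
    simp
  have denominator : HasExpansion (fun t => (1 - Complex.exp (-(t * ω))) / t) φ := by
    refine .of_mul_X ?_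
    rw [← hφ]
    refine (HasExpansion.one.sub (hasExpansion_exp_mul (-ω))).congr ?_
    filter_upwards [self_mem_nhdsWithin] with t (ht : t ≠ 0)
    rw [mul_div_cancel₀ _ ht, mul_neg]
  have inverse : φ * toddSeries ω = 1 := mul_left_cancel₀ X_ne_zero <| by
    rw [← mul_assoc, ← hφ, one_sub_rescale_exp_mul_toddSeries hω, mul_one]
  simpa only [inv_div] using denominator.inv inverse

end AsymptoticExpansion

section Bounds

open Complex Set

theorem exists_pos_le_norm_one_sub_exp_of_abs_re_le {ε : ℝ} (hε : 0 < ε) (r : ℝ) :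
    ∃ m > 0, ∀ u : ℂ, |u.re| ≤ r → (∀ j : ℤ, ε ≤ ‖u - j * (2 * Real.pi * I)‖) →
      m ≤ ‖1 - exp (-u)‖ := by
  set K : Set ℂ := (Icc (-r) r ×ℂ Icc (-Real.pi) (-Real.pi + 2 * Real.pi)) ∩
    ⋂ j : ℤ, {u | ε ≤ ‖u - j * (2 * Real.pi * I)‖}
  have K_compact : IsCompact K := (isCompact_Icc.reProdIm isCompact_Icc).inter_right <|
    isClosed_iInter fun j => isClosed_le continuous_const (by fun_prop)
  obtain ⟨m, hm, hmK⟩ : ∃ m > 0, ∀ u ∈ K, m ≤ ‖1 - exp (-u)‖ := by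
    refine K_compact.exists_forall_le' (by fun_prop) fun u hu => ?_
    rw [norm_pos_iff, sub_ne_zero]
    intro h
    obtain ⟨n, hn⟩ := exp_eq_one_iff.1 h.symm
    have far : ε ≤ ‖u - (-n : ℤ) * (2 * Real.pi * I)‖ := mem_iInter.1 hu.2 (-n)
    rw [Int.cast_neg, neg_mul, ← hn, neg_neg, sub_self, norm_zero] at far
    exact far.not_gt hε
  refine ⟨m, hm, fun u hre hu => ?_⟩
  set n := toIocDiv Real.two_pi_pos (-Real.pi) u.im
  have period : exp (-(u - n * (2 * Real.pi * I))) = exp (-u) :=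
    exp_eq_exp_iff_exists_int.2 ⟨n, by ring⟩
  rw [← period]
  refine hmK _ ⟨mem_reProdIm.2 ⟨?_, ?_⟩, mem_iInter.2 fun j => ?_⟩
  · simpa [← abs_le] using hre
  · have := Ioc_subset_Icc_self (sub_toIocDiv_zsmul_mem_Ioc Real.two_pi_pos (-Real.pi) u.im)
    rw [zsmul_eq_mul] at this
    convert this using 1
    simp [n]
  · have := hu (n + j)
    push_cast at this
    rwa [mem_ofPred_eq, sub_sub, ← add_mul]

theorem exists_pos_mul_max_le_norm_one_sub_exp {ε : ℝ} (hε : 0 < ε) :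
    ∃ m > 0, ∀ u : ℂ, (∀ j : ℤ, ε ≤ ‖u - j * (2 * Real.pi * I)‖) →
      m * max 1 (Real.exp (-u.re)) ≤ ‖1 - exp (-u)‖ := by
  obtain ⟨m, hm, near⟩ := exists_pos_le_norm_one_sub_exp_of_abs_re_le hε 1
  have exp_lt_one : Real.exp (-1) < 1 := Real.exp_lt_one_iff.2 (by norm_num)
  refine ⟨min (m * Real.exp (-1)) (1 - Real.exp (-1)),
    lt_min (by positivity) (by linarith), fun u hu => ?_⟩
  have norm_exp_neg : ‖exp (-u)‖ = Real.exp (-u.re) := by rw [norm_exp, neg_re]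
  rcases le_or_gt |u.re| 1 with hre | hre
  · have max_le_exp : max 1 (Real.exp (-u.re)) ≤ Real.exp 1 :=
      max_le (Real.one_le_exp zero_le_one) (Real.exp_le_exp.2 (by linarith [(abs_le.1 hre).1]))
    calc _ ≤ m * Real.exp (-1) * Real.exp 1 :=
          mul_le_mul (min_le_left _ _) max_le_exp (by positivity) (by positivity)
      _ = m := by rw [mul_assoc, ← Real.exp_add, neg_add_cancel, Real.exp_zero, mul_one]
      _ ≤ _ := near u hre hu
  refine (mul_le_mul_of_nonneg_right (min_le_right _ _) (by positivity)).trans ?_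
  rcases lt_abs.1 hre with right | left
  · have small : Real.exp (-u.re) ≤ Real.exp (-1) := Real.exp_le_exp.2 (by linarith)
    have reverse := norm_sub_norm_le (1 : ℂ) (exp (-u))
    rw [norm_exp_neg, norm_one] at reverse
    rw [max_eq_left (by linarith), mul_one]
    linarith
  · have large : 1 ≤ Real.exp (-1) * Real.exp (-u.re) := by
      rw [← Real.exp_add]
      exact Real.one_le_exp (by linarith)
    have reverse := norm_sub_norm_le (exp (-u)) 1
    rw [norm_exp_neg, norm_one, norm_sub_rev] at reverse
    rw [max_eq_right (Real.one_le_exp (by linarith))]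
    linarith

theorem exists_norm_exp_div_one_sub_exp_le {s ε : ℝ} (hs : s ∈ Ioo 0 1) (hε : 0 < ε) :
    ∃ C > 0, ∃ c > 0, ∀ u : ℂ, (∀ j : ℤ, ε ≤ ‖u - j * (2 * Real.pi * I)‖) →
      ‖exp (-(s * u)) / (1 - exp (-u))‖ ≤ C * Real.exp (-(c * |u.re|)) := by
  obtain ⟨m, hm, lower⟩ := exists_pos_mul_max_le_norm_one_sub_exp hε
  refine ⟨m⁻¹, inv_pos.2 hm, min s (1 - s), lt_min hs.1 (sub_pos.2 hs.2), fun u hu => ?_⟩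
  have norm_num_eq : ‖exp (-(s * u))‖ = Real.exp (-(s * u.re)) := by
    rw [norm_exp, neg_re, re_ofReal_mul]
  have exp_le : Real.exp (-(s * u.re)) ≤
      Real.exp (-(min s (1 - s) * |u.re|)) * max 1 (Real.exp (-u.re)) := by
    rcases le_total 0 u.re with h | h
    · refine le_trans ?_ (mul_le_mul_of_nonneg_left (le_max_left _ _) (Real.exp_nonneg _))
      rw [mul_one, abs_of_nonneg h]
      exact Real.exp_le_exp.2 (by nlinarith [min_le_left s (1 - s)])
    · refine le_trans ?_ (mul_le_mul_of_nonneg_left (le_max_right _ _) (Real.exp_nonneg _))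
      rw [← Real.exp_add, abs_of_nonpos h]
      exact Real.exp_le_exp.2 (by nlinarith [min_le_right s (1 - s)])
  rw [norm_div, norm_num_eq, div_le_iff₀ (lt_of_lt_of_le (by positivity) (lower u hu))]
  calc _ ≤ _ := exp_le
    _ = m⁻¹ * Real.exp (-(min s (1 - s) * |u.re|)) * (m * max 1 (Real.exp (-u.re))) := by
      field_simp
    _ ≤ _ := mul_le_mul_of_nonneg_left (lower u hu) (by positivity)

theorem exists_subinterval_far_from_multiples {ρ A ℓ : ℝ} (hℓ : 0 < ℓ) (hρ : ℓ < ρ) :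
    ∃ A', A ≤ A' ∧ A' + ℓ / 5 ≤ A + ℓ ∧
      ∀ r ∈ Icc A' (A' + ℓ / 5), ∀ j : ℤ, ℓ / 10 ≤ |r - j * ρ| := by
  by_cases h : ∃ j : ℤ, |A + 3 * ℓ / 10 - j * ρ| < ℓ / 5
  · obtain ⟨j, hj⟩ := h
    refine ⟨A + 3 * ℓ / 5, by linarith, by linarith, fun r hr i => ?_⟩
    rw [abs_lt] at hj
    by_contra! hi
    rw [abs_lt] at hi
    have hρ0 : 0 < ρ := hℓ.trans hρ
    have lt_one : ((i - j : ℤ) : ℝ) < 1 := by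
      refine lt_of_mul_lt_mul_right ?_ hρ0.le
      push_cast
      linarith [hr.1, hr.2]
    have pos : (0 : ℝ) < (i - j : ℤ) := by
      refine lt_of_mul_lt_mul_right ?_ hρ0.le
      push_cast
      linarith [hr.1, hr.2]
    norm_cast at lt_one pos
    omega
  · push Not at h
    refine ⟨A + ℓ / 5, by linarith, by linarith, fun r hr i => ?_⟩
    have close : |r - (A + 3 * ℓ / 10)| ≤ ℓ / 10 := by
      rw [abs_le]
      constructor <;> linarith [hr.1, hr.2]
    have := abs_sub (r - i * ρ) (r - (A + 3 * ℓ / 10))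
    rw [sub_sub_sub_cancel_left] at this
    linarith [h i]

theorem exists_interval_far_from_multiples {ι : Type*} (s : Finset ι) {ρ : ι → ℝ}
    (hρ : ∀ k, 0 < ρ k) {ℓ₀ : ℝ} (hℓ₀ : 0 < ℓ₀) :
    ∃ ε > 0, ∃ ℓ > 0, ℓ ≤ ℓ₀ ∧ ∀ A : ℝ, ∃ A' ≥ A,
      ∀ r ∈ Icc A' (A' + ℓ), ∀ k ∈ s, ∀ j : ℤ, ε ≤ |r - j * ρ k| := by
  classical
  induction s using Finset.induction_on generalizing ℓ₀ with
  | empty => exact ⟨1, one_pos, ℓ₀, hℓ₀, le_rfl, fun A => ⟨A, le_rfl, by simp⟩⟩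
  | insert i s _ ih =>
    obtain ⟨ε, hε, ℓ, hℓ, hle, far⟩ := ih (lt_min hℓ₀ (half_pos (hρ i)))
    have hlρ : ℓ < ρ i := by linarith [min_le_right ℓ₀ (ρ i / 2), hρ i]
    refine ⟨min ε (ℓ / 10), lt_min hε (by linarith), ℓ / 5, by linarith,
      by linarith [min_le_left ℓ₀ (ρ i / 2)], fun A => ?_⟩
    obtain ⟨A₁, hA₁, far₁⟩ := far A
    obtain ⟨A₂, hA₂, hA₂', far₂⟩ := exists_subinterval_far_from_multiples (A := A₁) hℓ hlρ
    refine ⟨A₂, hA₁.le.trans hA₂, fun r hr => (Finset.forall_mem_insert _ _ _).2 ⟨fun j => ?_,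
      fun k hk j => ?_⟩⟩
    · exact (min_le_right _ _).trans (far₂ r hr j)
    · exact (min_le_left _ _).trans (far₁ r ⟨hA₂.trans hr.1, hr.2.trans hA₂'⟩ k hk j)

theorem exists_radius_far_from_multiples {ι : Type*} [Finite ι] {ρ : ι → ℝ}
    (hρ : ∀ k, 0 < ρ k) :
    ∃ ε > 0, ∀ M : ℝ, ∃ R ≥ M, ∀ k, ∀ j : ℤ, ε ≤ |R - j * ρ k| := by
  have := Fintype.ofFinite ι
  obtain ⟨ε, hε, ℓ, hℓ, -, far⟩ := exists_interval_far_from_multiples Finset.univ hρ one_pos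
  refine ⟨ε, hε, fun M => ?_⟩
  obtain ⟨R, hR, far⟩ := far M
  exact ⟨R, hR, fun k => far R ⟨le_rfl, by linarith⟩ k (Finset.mem_univ k)⟩

end Bounds

section Kernel

open Filter Topology Complex

variable {ι : Type*} {o : ι → ℂ}

/-- The periods `o k` are pairwise linearly independent over the reals. -/
def PairIndep (o : ι → ℂ) : Prop :=
  Pairwise fun k l => (o k * (starRingEnd ℂ) (o l)).im ≠ 0

theorem PairIndep.ne_zero [Nontrivial ι] (h : PairIndep o) (k : ι) : o k ≠ 0 := by
  obtain ⟨l, hl⟩ := exists_ne k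
  intro h0
  simpa [h0] using h hl.symm

theorem PairIndep.int_mul_ne (h : PairIndep o) {k l : ι} (hkl : l ≠ k) {i j : ℤ} (hj : j ≠ 0) :
    (j : ℂ) * o l ≠ i * o k := by
  intro heq
  have := congrArg (fun u => (u * (starRingEnd ℂ) (o k)).im) heq
  simp only [mul_assoc, mul_conj] at this
  rw [← ofReal_intCast, ← ofReal_intCast, im_ofReal_mul, im_ofReal_mul, ofReal_im, mul_zero] at this
  exact h hkl ((mul_eq_zero.1 this).resolve_left (Int.cast_ne_zero.2 hj))

theorem exists_int_of_one_sub_exp_neg_eq_zero {u : ℂ} (h : 1 - exp (-u) = 0) :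
    ∃ j : ℤ, u = 2 * Real.pi * I * j := by
  obtain ⟨n, hn⟩ := exp_eq_one_iff.1 (sub_eq_zero.1 h).symm
  refine ⟨-n, ?_⟩
  rw [← neg_inj, hn]
  push_cast
  ring

/-- The nonzero poles (`j ≠ 0`) of the Barnes kernel with periods `o`. -/
def kernelPole (o : ι → ℂ) (k : ι) (j : ℤ) : ℂ :=
  2 * Real.pi * I * j / o k

theorem kernelPole_mul {k : ι} (hk : o k ≠ 0) (j : ℤ) :
    kernelPole o k j * o k = 2 * Real.pi * I * j :=
  div_mul_cancel₀ _ hk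

theorem norm_kernelPole (o : ι → ℂ) (k : ι) (j : ℤ) :
    ‖kernelPole o k j‖ = |j| * (2 * Real.pi / ‖o k‖) := by
  simp only [kernelPole, norm_div, norm_mul, Complex.norm_two, norm_real, norm_I, norm_intCast,
    Real.norm_of_nonneg Real.pi_pos.le, Int.cast_abs]
  ring

theorem kernelPole_ne_zero {k : ι} (hk : o k ≠ 0) {j : ℤ} (hj : j ≠ 0) :
    kernelPole o k j ≠ 0 :=
  div_ne_zero (mul_ne_zero two_pi_I_ne_zero (Int.cast_ne_zero.2 hj)) hk

theorem PairIndep.one_sub_exp_kernelPole_ne_zero [Nontrivial ι] (h : PairIndep o) {k l : ι}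
    (hkl : l ≠ k) {j : ℤ} (hj : j ≠ 0) : 1 - exp (-(kernelPole o k j * o l)) ≠ 0 := by
  intro h0
  obtain ⟨n, hn⟩ := exists_int_of_one_sub_exp_neg_eq_zero h0
  refine h.int_mul_ne hkl (i := n) hj (mul_left_cancel₀ two_pi_I_ne_zero ?_)
  rw [← mul_assoc, ← mul_assoc, ← hn, ← kernelPole_mul (h.ne_zero k) j]
  ring

theorem PairIndep.kernelPole_injective [Nontrivial ι] (h : PairIndep o) {k l : ι} {i j : ℤ}
    (hj : j ≠ 0) (heq : kernelPole o l i = kernelPole o k j) : l = k ∧ i = j := by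
  have cross : (j : ℂ) * o l = i * o k := by
    refine mul_left_cancel₀ two_pi_I_ne_zero ?_
    rw [← mul_assoc, ← mul_assoc, ← kernelPole_mul (h.ne_zero k) j,
      ← kernelPole_mul (h.ne_zero l) i, heq]
    ring
  have hlk : l = k := by
    by_contra hlk
    exact h.int_mul_ne hlk hj cross
  subst hlk
  exact ⟨rfl, Int.cast_injective (mul_right_cancel₀ (h.ne_zero l) cross).symm⟩

/-- The indices `j` for which `kernelPole o k j` lies in the open disc of radius `R`. -/
def poleIndices (o : ι → ℂ) (R : ℝ) (k : ι) : Finset ℤ :=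
  Finset.Ioo (-⌈R / (2 * Real.pi / ‖o k‖)⌉) ⌈R / (2 * Real.pi / ‖o k‖)⌉

theorem mem_poleIndices (ho : ∀ k, o k ≠ 0) {R : ℝ} {k : ι} {j : ℤ} :
    j ∈ poleIndices o R k ↔ ‖kernelPole o k j‖ < R := by
  have hk : 0 < 2 * Real.pi / ‖o k‖ := div_pos Real.two_pi_pos (norm_pos_iff.2 (ho k))
  rw [norm_kernelPole, ← lt_div_iff₀ hk, poleIndices, Finset.mem_Ioo, neg_lt, Int.lt_ceil,
    Int.lt_ceil, Int.cast_abs, abs_lt, neg_lt, Int.cast_neg]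

variable [Fintype ι]

/-- The kernel of Barnes' contour integrals for the multiple zeta and gamma functions with periods
`o`. -/
def barnesKernel (o : ι → ℂ) (z t : ℂ) : ℂ :=
  exp (t * z) / (t * ∏ k, (1 - exp (-(t * o k))))

/-- The residue of the Barnes kernel at the origin, up to the normalisation a multiple Bernoulli
polynomial. -/
def originResidue (o : ι → ℂ) (z : ℂ) : ℂ :=
  PowerSeries.coeff (Fintype.card ι)
    (PowerSeries.rescale z (PowerSeries.exp ℂ) * ∏ k, toddSeries (o k))

/-- The residue of the Barnes kernel at `kernelPole o k j`. Its value is `0` for `j = 0`. -/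
def poleResidue [DecidableEq ι] (o : ι → ℂ) (z : ℂ) (k : ι) (j : ℤ) : ℂ :=
  exp (kernelPole o k j * z) /
    (2 * Real.pi * I * j * ∏ l ∈ Finset.univ.erase k, (1 - exp (-(kernelPole o k j * o l))))

theorem hasResidueAt_barnesKernel_zero (ho : ∀ k, o k ≠ 0) (z : ℂ) :
    HasResidueAt (barnesKernel o z) 0 (originResidue o z) := by
  refine HasExpansion.hasResidueAt (((hasExpansion_exp_mul z).mul
    (HasExpansion.prod Finset.univ fun k => hasExpansion_todd (ho k))).congr ?_)
  filter_upwards [self_mem_nhdsWithin] with t (ht : t ≠ 0)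
  rw [Finset.prod_div_distrib, Finset.prod_const, Finset.card_univ, barnesKernel, pow_succ]
  field_simp

theorem hasResidueAt_barnesKernel_kernelPole [Nontrivial ι] [DecidableEq ι] (h : PairIndep o)
    (z : ℂ) (k : ι) {j : ℤ} (hj : j ≠ 0) :
    HasResidueAt (barnesKernel o z) (kernelPole o k j) (poleResidue o z k j) := by
  set s := kernelPole o k j
  have hk := h.ne_zero k
  have hso : s * o k = 2 * Real.pi * I * j := kernelPole_mul hk j
  have exp_eq_one : exp (-(s * o k)) = 1 :=
    exp_eq_one_iff.2 ⟨-j, by rw [hso]; push_cast; ring⟩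
  set N : ℂ → ℂ := fun t =>
    exp (t * z) / (t * ∏ l ∈ Finset.univ.erase k, (1 - exp (-(t * o l))))
  have N_diff : DifferentiableAt ℂ N s := by
    refine DifferentiableAt.fun_div (by fun_prop) (by fun_prop) ?_
    exact mul_ne_zero (kernelPole_ne_zero hk hj) <| Finset.prod_ne_zero_iff.2 fun l hl =>
      h.one_sub_exp_kernelPole_ne_zero (Finset.ne_of_mem_erase hl) hj
  have D_deriv : HasDerivAt (fun t => 1 - exp (-(t * o k))) (o k) s := by
    simpa [exp_eq_one] using (((hasDerivAt_id s).mul_const (o k)).neg.cexp).const_sub 1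
  have residue := hasResidueAt_div_of_simple_zero N_diff (D := fun t => 1 - exp (-(t * o k)))
    (by fun_prop) (by rw [exp_eq_one, sub_self]) D_deriv hk
  convert residue using 1
  · funext t
    rw [barnesKernel, ← Finset.prod_erase_mul _ _ (Finset.mem_univ k), ← mul_assoc, div_div]
  · rw [poleResidue, ← hso, div_div, mul_right_comm]

theorem differentiableAt_barnesKernel (ho : ∀ k, o k ≠ 0) (z : ℂ) {t : ℂ} (ht : t ≠ 0)
    (h : ∀ k, ∀ j : ℤ, j ≠ 0 → t ≠ kernelPole o k j) :
    DifferentiableAt ℂ (barnesKernel o z) t := by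
  unfold barnesKernel
  refine DifferentiableAt.fun_div (by fun_prop) (by fun_prop) ?_
  refine mul_ne_zero ht (Finset.prod_ne_zero_iff.2 fun k _ h0 => ?_)
  obtain ⟨j, hj⟩ := exists_int_of_one_sub_exp_neg_eq_zero h0
  have t_eq : t = kernelPole o k j := eq_div_of_mul_eq (ho k) hj
  refine h k j ?_ t_eq
  rintro rfl
  exact ht (by simpa [kernelPole] using t_eq)

theorem circleIntegral_barnesKernel [Nontrivial ι] [DecidableEq ι] (h : PairIndep o) (z : ℂ) {R : ℝ}
    (hR : 0 < R) (hfar : ∀ k j, ‖kernelPole o k j‖ ≠ R) :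
    (∮ t in C(0, R), barnesKernel o z t) = 2 * Real.pi * I *
      (originResidue o z + ∑ k, ∑ j ∈ poleIndices o R k, poleResidue o z k j) := by
  set J : Finset (Σ _ : ι, ℤ) := Finset.univ.sigma fun k => (poleIndices o R k).erase 0
  have mem_J : ∀ q, q ∈ J ↔ q.2 ≠ 0 ∧ ‖kernelPole o q.1 q.2‖ < R := fun q => by
    simp only [J, Finset.mem_sigma, Finset.mem_univ, true_and, Finset.mem_erase,
      mem_poleIndices h.ne_zero]
  set s : Option (Σ _ : ι, ℤ) → ℂ := fun q => q.elim 0 fun q => kernelPole o q.1 q.2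
  set r : Option (Σ _ : ι, ℤ) → ℂ := fun q => q.elim (originResidue o z) fun q =>
    poleResidue o z q.1 q.2
  have sum_r : ∑ q ∈ J.insertNone, r q =
      originResidue o z + ∑ k, ∑ j ∈ poleIndices o R k, poleResidue o z k j := by
    rw [Finset.sum_insertNone, Finset.sum_sigma]
    congr 1
    exact Finset.sum_congr rfl fun k _ => Finset.sum_erase _
      (show poleResidue o z k 0 = 0 by simp [poleResidue])
  have s_ne_zero : ∀ q ∈ J, kernelPole o q.1 q.2 ≠ 0 := fun q hq =>
    kernelPole_ne_zero (h.ne_zero _) ((mem_J q).1 hq).1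
  rw [circleIntegral_eq_sum_residues J.insertNone (s := s) (r := r) hR, sum_r]
  · rintro (_ | q) hq
    · simpa [s] using hR
    · simpa [s] using ((mem_J q).1 (by simpa using hq)).2
  · rintro (_ | q) hq (_ | q') hq' hqq
    · rfl
    · exact absurd hqq.symm (s_ne_zero q' (by simpa using hq'))
    · exact absurd hqq (s_ne_zero q (by simpa using hq))
    · obtain ⟨hk, hj⟩ := h.kernelPole_injective ((mem_J q').1 (by simpa using hq')).1 hqq
      exact congrArg some (Sigma.ext hk (heq_of_eq hj))
  · intro t ht hne
    refine differentiableAt_barnesKernel h.ne_zero z (hne none (by simp)) fun k j hj htj => ?_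
    refine hne (some ⟨k, j⟩) ?_ htj
    refine Finset.some_mem_insertNone.2 ((mem_J _).2 ⟨hj, lt_of_le_of_ne ?_ (hfar k j)⟩)
    simpa [← htj] using ht
  · rintro (_ | q) hq
    · exact hasResidueAt_barnesKernel_zero h.ne_zero z
    · exact hasResidueAt_barnesKernel_kernelPole h z q.1 ((mem_J q).1 (by simpa using hq)).1

end Kernel

section ResidueSum

open Filter Topology Complex Set

theorem exists_pos_mul_norm_le_of_im_mul_conj_ne_zero {p q : ℂ}
    (h : (p * (starRingEnd ℂ) q).im ≠ 0) :
    ∃ m > 0, ∀ t : ℂ, m * ‖t‖ ≤ |(t * p).re| + |(t * q).re| := by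
  have hp : 0 < ‖p‖ := norm_pos_iff.2 (by rintro rfl; simp at h)
  have : 0 < |(p * (starRingEnd ℂ) q).im| := abs_pos.2 h
  refine ⟨|(p * (starRingEnd ℂ) q).im| / (‖p‖ + ‖q‖), by positivity, fun t => ?_⟩
  have cramer : ((p * (starRingEnd ℂ) q).im : ℂ) * (I * t) =
      ((t * p).re : ℂ) * (starRingEnd ℂ) q - ((t * q).re : ℂ) * (starRingEnd ℂ) p := by
    apply Complex.ext <;> simp <;> ring
  have norm_le := norm_sub_le (((t * p).re : ℂ) * (starRingEnd ℂ) q)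
    (((t * q).re : ℂ) * (starRingEnd ℂ) p)
  rw [← cramer] at norm_le
  simp only [norm_mul, norm_real, norm_I, one_mul, RCLike.norm_conj, Real.norm_eq_abs] at norm_le
  rw [div_mul_eq_mul_div, div_le_iff₀ (by positivity)]
  nlinarith [abs_nonneg (t * p).re, abs_nonneg (t * q).re, norm_nonneg p, norm_nonneg q]

variable {ι : Type*} [Fintype ι] {o : ι → ℂ} {s : ι → ℝ}

theorem barnesKernel_neg_sum (o : ι → ℂ) (s : ι → ℝ) (t : ℂ) :
    barnesKernel o (-∑ k, s k * o k) t =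
      (∏ k, exp (-(s k * (t * o k))) / (1 - exp (-(t * o k)))) / t := by
  rw [Finset.prod_div_distrib, ← exp_sum, barnesKernel, div_div, mul_comm _ t, mul_neg,
    Finset.mul_sum, ← Finset.sum_neg_distrib]
  simp only [mul_left_comm t]

theorem le_norm_mul_sub_of_le_abs_norm_sub {t p : ℂ} {ε : ℝ} (hp : p ≠ 0)
    (h : ∀ j : ℤ, ε ≤ |‖t‖ - j * (2 * Real.pi / ‖p‖)|) (j : ℤ) :
    ε * ‖p‖ ≤ ‖t * p - j * (2 * Real.pi * I)‖ := by
  have hp' : 0 < ‖p‖ := norm_pos_iff.2 hp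
  refine le_trans ?_ (abs_norm_sub_norm_le (t * p) (j * (2 * Real.pi * I)))
  have factor_norm : ‖t * p‖ - ‖(j : ℂ) * (2 * Real.pi * I)‖ =
      (‖t‖ - (|j| : ℤ) * (2 * Real.pi / ‖p‖)) * ‖p‖ := by
    simp only [norm_mul, norm_intCast, Complex.norm_two, norm_real, norm_I,
      Real.norm_of_nonneg Real.pi_pos.le, Int.cast_abs]
    field_simp
  rw [factor_norm, abs_mul, abs_of_pos hp']
  exact mul_le_mul_of_nonneg_right (h |j|) hp'.le

variable [Nontrivial ι]

theorem exists_norm_barnesKernel_le (h : PairIndep o) (hs : ∀ k, s k ∈ Ioo (0 : ℝ) 1) {ε : ℝ}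
    (hε : 0 < ε) :
    ∃ C > 0, ∃ c > 0, ∀ t : ℂ, (∀ k, ∀ j : ℤ, ε ≤ |‖t‖ - j * (2 * Real.pi / ‖o k‖)|) →
      ‖barnesKernel o (-∑ k, s k * o k) t‖ ≤ C * Real.exp (-(c * ‖t‖)) / ‖t‖ := by
  choose C hC c hc bound using fun k => exists_norm_exp_div_one_sub_exp_le (hs k)
    (mul_pos hε (norm_pos_iff.2 (h.ne_zero k)))
  obtain ⟨i, j, hij⟩ := exists_pair_ne ι
  obtain ⟨m, hm, norm_le⟩ := exists_pos_mul_norm_le_of_im_mul_conj_ne_zero (h hij)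
  have hmin : 0 < min (c i) (c j) := lt_min (hc i) (hc j)
  refine ⟨∏ k, C k, Finset.prod_pos fun k _ => hC k, min (c i) (c j) * m, mul_pos hmin hm,
    fun t ht => ?_⟩
  have exponent_le : min (c i) (c j) * m * ‖t‖ ≤ ∑ k, c k * |(t * o k).re| :=
    calc min (c i) (c j) * m * ‖t‖
        ≤ min (c i) (c j) * (|(t * o i).re| + |(t * o j).re|) := by
          rw [mul_assoc]
          exact mul_le_mul_of_nonneg_left (norm_le t) hmin.le
      _ ≤ c i * |(t * o i).re| + c j * |(t * o j).re| := by
          rw [mul_add]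
          gcongr
          exacts [min_le_left _ _, min_le_right _ _]
      _ ≤ ∑ k, c k * |(t * o k).re| :=
          Finset.add_le_sum (f := fun k => c k * |(t * o k).re|)
            (fun k _ => mul_nonneg (hc k).le (abs_nonneg _))
            (Finset.mem_univ i) (Finset.mem_univ j) hij
  rw [barnesKernel_neg_sum, norm_div, norm_prod]
  gcongr
  calc _ ≤ ∏ k, C k * Real.exp (-(c k * |(t * o k).re|)) :=
        Finset.prod_le_prod (fun _ _ => norm_nonneg _) fun k _ =>
          bound k _ (le_norm_mul_sub_of_le_abs_norm_sub (h.ne_zero k) (ht k))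
    _ = (∏ k, C k) * Real.exp (-∑ k, c k * |(t * o k).re|) := by
        rw [Finset.prod_mul_distrib, ← Finset.sum_neg_distrib, Real.exp_sum]
    _ ≤ _ := mul_le_mul_of_nonneg_left (Real.exp_le_exp.2 (neg_le_neg exponent_le))
        (Finset.prod_nonneg fun k _ => (hC k).le)

theorem exists_radii_tendsto_circleIntegral (h : PairIndep o) (hs : ∀ k, s k ∈ Ioo (0 : ℝ) 1) :
    ∃ R : ℕ → ℝ, (∀ n, 0 < R n) ∧ Tendsto R atTop atTop ∧
      (∀ n k j, ‖kernelPole o k j‖ ≠ R n) ∧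
      Tendsto (fun n => ∮ t in C(0, R n), barnesKernel o (-∑ k, s k * o k) t) atTop (𝓝 0) := by
  obtain ⟨ε, hε, radius⟩ := exists_radius_far_from_multiples (ρ := fun k => 2 * Real.pi / ‖o k‖)
    fun k => div_pos (by positivity) (norm_pos_iff.2 (h.ne_zero k))
  choose R hR hfar using fun n : ℕ => radius (n + 1)
  have R_pos : ∀ n, 0 < R n := fun n => lt_of_lt_of_le (by positivity) (hR n)
  have R_tendsto : Tendsto R atTop atTop := tendsto_atTop_mono hR
    (tendsto_atTop_add_const_right _ _ tendsto_natCast_atTop_atTop)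
  obtain ⟨C, -, c, hc, bound⟩ := exists_norm_barnesKernel_le h hs hε
  refine ⟨R, R_pos, R_tendsto, fun n k j hj => ?_, ?_⟩
  · have := hfar n k |j|
    rw [← hj, norm_kernelPole, sub_self, abs_zero] at this
    exact this.not_gt hε
  have majorant : Tendsto (fun n => 2 * Real.pi * C * Real.exp (-(c * R n))) atTop (𝓝 0) := by
    simpa using (Real.tendsto_exp_neg_atTop_nhds_zero.comp
      (R_tendsto.const_mul_atTop hc)).const_mul (2 * Real.pi * C)
  refine squeeze_zero_norm (fun n => ?_) majorant
  refine (circleIntegral.norm_integral_le_of_norm_le_const (R_pos n).le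
    (C := C * Real.exp (-(c * R n)) / R n) fun t ht => ?_).trans_eq ?_
  · have htR : ‖t‖ = R n := by simpa using ht
    simpa only [htR] using bound t (by rw [htR]; exact hfar n)
  · have := (R_pos n).ne'
    field_simp

/-- The hypothesis on `z` makes the kernel decay along all directions, so that its integrals over
large circles tend to zero. -/
theorem sum_tsum_poleResidue [DecidableEq ι] (h : PairIndep o) (hs : ∀ k, s k ∈ Ioo (0 : ℝ) 1)
    {z : ℂ} (hz : z = -∑ k, s k * o k) (hsum : ∀ k, Summable (poleResidue o z k)) :
    ∑ k, ∑' j, poleResidue o z k j = -originResidue o z := by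
  obtain ⟨R, R_pos, R_tendsto, R_ne, integral_tendsto⟩ := exists_radii_tendsto_circleIntegral h hs
  have exhausts : ∀ k, Tendsto (fun n => poleIndices o (R n) k) atTop atTop := fun k =>
    tendsto_atTop.2 fun S => (eventually_all_finset S).2 fun j _ =>
      (R_tendsto.eventually_gt_atTop ‖kernelPole o k j‖).mono fun n hn =>
        (mem_poleIndices h.ne_zero).2 hn
  have limit : Tendsto (fun n => 2 * Real.pi * I *
      (originResidue o z + ∑ k, ∑ j ∈ poleIndices o (R n) k, poleResidue o z k j)) atTop
      (𝓝 (2 * Real.pi * I * (originResidue o z + ∑ k, ∑' j, poleResidue o z k j))) :=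
    ((tendsto_finsetSum _ fun k _ => (hsum k).hasSum.comp (exhausts k)).const_add _).const_mul _
  simp only [← circleIntegral_barnesKernel h z (R_pos _) (R_ne _)] at limit
  rw [← hz] at integral_tendsto
  exact eq_neg_of_add_eq_zero_right <|
    (mul_eq_zero.1 (tendsto_nhds_unique limit integral_tendsto)).resolve_left two_pi_I_ne_zero

end ResidueSum

section DoubleProducts

open Complex

/-- The exponential function of period `p`, normalised to have the value `1` at `p`. -/
def expPeriod (p u : ℂ) : ℂ :=
  exp (2 * Real.pi * I * u / p)

theorem expPeriod_ne_zero (p u : ℂ) : expPeriod p u ≠ 0 :=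
  exp_ne_zero _

theorem expPeriod_add (p u v : ℂ) : expPeriod p (u + v) = expPeriod p u * expPeriod p v := by
  rw [expPeriod, mul_add, add_div, exp_add, expPeriod, expPeriod]

theorem expPeriod_neg (p u : ℂ) : expPeriod p (-u) = (expPeriod p u)⁻¹ := by
  rw [expPeriod, mul_neg, neg_div, exp_neg, expPeriod]

theorem expPeriod_natCast_mul (p : ℂ) (n : ℕ) (u : ℂ) :
    expPeriod p (n * u) = expPeriod p u ^ n := by
  rw [expPeriod, expPeriod, ← exp_nat_mul]
  congr 1
  ring

theorem norm_expPeriod (p u : ℂ) : ‖expPeriod p u‖ = Real.exp (-(2 * Real.pi * (u / p).im)) := by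
  rw [expPeriod, norm_exp, mul_div_assoc, ← ofReal_ofNat, ← ofReal_mul, mul_assoc, re_ofReal_mul,
    I_mul_re, mul_neg]

theorem norm_expPeriod_lt_one {p u : ℂ} (h : 0 < (u / p).im) : ‖expPeriod p u‖ < 1 := by
  rw [norm_expPeriod, Real.exp_lt_one_iff, neg_lt_zero]
  positivity

theorem one_sub_ne_zero_of_norm_lt_one {q : ℂ} (hq : ‖q‖ < 1) : 1 - q ≠ 0 := by
  rintro h
  rw [← sub_eq_zero.1 h, norm_one] at hq
  exact lt_irrefl _ hq

theorem one_sub_pow_succ_ne_zero {q : ℂ} (hq : ‖q‖ < 1) (n : ℕ) : 1 - q ^ (n + 1) ≠ 0 :=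
  one_sub_ne_zero_of_norm_lt_one
    ((norm_pow q _).trans_lt (pow_lt_one₀ (norm_nonneg _) hq n.succ_ne_zero))

theorem norm_mul_pow_mul_pow_lt_one {y q r : ℂ} (hy : ‖y‖ < 1) (hq : ‖q‖ < 1) (hr : ‖r‖ < 1)
    (m n : ℕ) : ‖y * q ^ m * r ^ n‖ < 1 := by
  rw [norm_mul, norm_mul, norm_pow, norm_pow]
  calc ‖y‖ * ‖q‖ ^ m * ‖r‖ ^ n ≤ ‖y‖ * 1 * 1 := by
        gcongr
        exacts [pow_le_one₀ (norm_nonneg _) hq.le, pow_le_one₀ (norm_nonneg _) hr.le]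
    _ < 1 := by simpa using hy

theorem summable_mul_pow_mul_pow_pow_div {y q r : ℂ} (hy : ‖y‖ < 1) (hq : ‖q‖ < 1)
    (hr : ‖r‖ < 1) :
    Summable fun t : (ℕ × ℕ) × ℕ => (y * q ^ t.1.1 * r ^ t.1.2) ^ (t.2 + 1) / ((t.2 : ℂ) + 1) := by
  have geom : ∀ {u : ℂ}, ‖u‖ < 1 → Summable fun n => ‖u‖ ^ n := fun hu =>
    summable_geometric_of_lt_one (norm_nonneg _) hu
  have majorant : Summable fun t : (ℕ × ℕ) × ℕ => ‖q‖ ^ t.1.1 * ‖r‖ ^ t.1.2 * ‖y‖ ^ t.2 :=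
    ((geom hq).mul_of_nonneg (geom hr) (fun _ => by positivity)
      fun _ => by positivity).mul_of_nonneg (geom hy)
      (fun _ => by simp only [Pi.zero_apply]; positivity) fun _ => by positivity
  refine Summable.of_norm_bounded majorant fun ⟨⟨m, n⟩, j⟩ => ?_
  have one_le : (1 : ℝ) ≤ ‖(j : ℂ) + 1‖ := by
    rw [← Nat.cast_succ, norm_natCast]
    exact_mod_cast Nat.succ_le_succ j.zero_le
  have pow_le : ∀ {u : ℂ}, ‖u‖ < 1 → ∀ m, (‖u‖ ^ m) ^ (j + 1) ≤ ‖u‖ ^ m := fun hu m =>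
    pow_le_of_le_one (by positivity) (pow_le_one₀ (norm_nonneg _) hu.le) j.succ_ne_zero
  have y_pow_le : ‖y‖ ^ (j + 1) ≤ ‖y‖ ^ j :=
    pow_le_pow_of_le_one (norm_nonneg _) hy.le j.le_succ
  simp only [norm_div, norm_pow, norm_mul]
  refine (div_le_self (by positivity) one_le).trans ?_
  rw [mul_pow, mul_pow]
  calc ‖y‖ ^ (j + 1) * (‖q‖ ^ m) ^ (j + 1) * (‖r‖ ^ n) ^ (j + 1)
      ≤ ‖y‖ ^ j * ‖q‖ ^ m * ‖r‖ ^ n := by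
        gcongr
        exacts [pow_le hq m, pow_le hr n]
    _ = ‖q‖ ^ m * ‖r‖ ^ n * ‖y‖ ^ j := by ring

theorem hasSum_mul_pow_mul_pow_pow {y q r : ℂ} (hq : ‖q‖ < 1) (hr : ‖r‖ < 1) (j : ℕ) :
    HasSum (fun p : ℕ × ℕ => (y * q ^ p.1 * r ^ p.2) ^ (j + 1) / ((j : ℂ) + 1))
      (y ^ (j + 1) / ((j + 1) * ((1 - q ^ (j + 1)) * (1 - r ^ (j + 1))))) := by
  have pow_lt : ∀ {u : ℂ}, ‖u‖ < 1 → ‖u ^ (j + 1)‖ < 1 := fun hu =>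
    (norm_pow _ _).trans_lt (pow_lt_one₀ (norm_nonneg _) hu j.succ_ne_zero)
  have geom := ((hasSum_geometric_of_norm_lt_one (pow_lt hq)).mul
    (hasSum_geometric_of_norm_lt_one (pow_lt hr))
    (summable_mul_of_summable_norm (summable_norm_geometric_of_norm_lt_one (pow_lt hq))
      (summable_norm_geometric_of_norm_lt_one (pow_lt hr)))).mul_left (y ^ (j + 1) / ((j : ℂ) + 1))
  rw [← mul_inv, ← div_eq_mul_inv, div_div] at geom
  refine geom.congr_fun fun p => ?_
  simp only [mul_pow, ← pow_mul, mul_comm p.1, mul_comm p.2]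
  ring

theorem exists_hasProd_one_sub_mul_pow {y q r : ℂ} (hy : ‖y‖ < 1) (hq : ‖q‖ < 1) (hr : ‖r‖ < 1) :
    ∃ S, HasSum (fun j : ℕ => y ^ (j + 1) / ((j + 1) * ((1 - q ^ (j + 1)) * (1 - r ^ (j + 1))))) S ∧
      HasProd (fun p : ℕ × ℕ => 1 - y * q ^ p.1 * r ^ p.2) (exp (-S)) := by
  have triple := (summable_mul_pow_mul_pow_pow_div hy hq hr).hasSum
  have lt_one := fun p : ℕ × ℕ => norm_mul_pow_mul_pow_lt_one hy hq hr p.1 p.2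
  refine ⟨_, ((Equiv.prodComm ℕ (ℕ × ℕ)).hasSum_iff.2 triple).prod_fiberwise
    (hasSum_mul_pow_mul_pow_pow hq hr), ?_⟩
  refine Complex.hasProd_of_hasSum_log (fun p => one_sub_ne_zero_of_norm_lt_one (lt_one p)) ?_
  have log_sum : HasSum (fun p : ℕ × ℕ => -log (1 - y * q ^ p.1 * r ^ p.2)) _ :=
    triple.prod_fiberwise fun p => by
      simpa using (hasSum_nat_add_iff' 1).2 (hasSum_taylorSeries_neg_log (lt_one p))
  simpa using log_sum.neg

variable {ι : Type*} [Fintype ι] [DecidableEq ι]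

theorem two_pi_I_mul_poleResidue (o : ι → ℂ) (z : ℂ) (k : ι) (j : ℤ) :
    2 * Real.pi * I * poleResidue o z k j = expPeriod (o k) (j * z) /
      (j * ∏ l ∈ Finset.univ.erase k, (1 - expPeriod (o k) (-(j * o l)))) := by
  have exp_eq : ∀ u, exp (kernelPole o k j * u) = expPeriod (o k) (j * u) := fun u => by
    rw [kernelPole, expPeriod]
    congr 1
    ring
  simp only [poleResidue, ← mul_neg, exp_eq]
  rw [mul_assoc _ (j : ℂ), ← div_div, mul_div_assoc', mul_div_cancel₀]
  exact two_pi_I_ne_zero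

variable {o : ι → ℂ} {z : ℂ} {k a b : ι}

theorem two_pi_I_mul_poleResidue_succ (hab : a ≠ b) (hk : Finset.univ.erase k = {a, b})
    (ha : ‖expPeriod (o k) (-o a)‖ < 1) (hb : ‖expPeriod (o k) (o b)‖ < 1) (n : ℕ) :
    2 * Real.pi * I * poleResidue o z k (n + 1 : ℕ) =
      -(expPeriod (o k) (z + o b) ^ (n + 1) / ((n + 1) *
        ((1 - expPeriod (o k) (-o a) ^ (n + 1)) * (1 - expPeriod (o k) (o b) ^ (n + 1))))) := by
  rw [two_pi_I_mul_poleResidue, hk, Finset.prod_pair hab, Int.cast_natCast, ← mul_neg, ← mul_neg,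
    expPeriod_natCast_mul, expPeriod_natCast_mul, expPeriod_natCast_mul, expPeriod_add, mul_pow,
    expPeriod_neg _ (o b), inv_pow, Nat.cast_succ]
  have := one_sub_pow_succ_ne_zero ha n
  have hb' := one_sub_pow_succ_ne_zero hb n
  have hB : expPeriod (o k) (o b) ^ (n + 1) ≠ 0 := pow_ne_zero _ (expPeriod_ne_zero _ _)
  rw [show 1 - (expPeriod (o k) (o b) ^ (n + 1))⁻¹ =
      -((1 - expPeriod (o k) (o b) ^ (n + 1)) / expPeriod (o k) (o b) ^ (n + 1)) by
    field_simp; ring]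
  field_simp

theorem two_pi_I_mul_poleResidue_neg_succ (hab : a ≠ b) (hk : Finset.univ.erase k = {a, b})
    (ha : ‖expPeriod (o k) (-o a)‖ < 1) (hb : ‖expPeriod (o k) (o b)‖ < 1) (n : ℕ) :
    2 * Real.pi * I * poleResidue o z k (-(n + 1)) =
      expPeriod (o k) (-z + -o a) ^ (n + 1) / ((n + 1) *
        ((1 - expPeriod (o k) (o b) ^ (n + 1)) * (1 - expPeriod (o k) (-o a) ^ (n + 1)))) := by
  have cast_eq : ((-((n : ℤ) + 1) : ℤ) : ℂ) = -((n + 1 : ℕ) : ℂ) := by push_cast; rfl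
  rw [two_pi_I_mul_poleResidue, hk, Finset.prod_pair hab, cast_eq, neg_mul, neg_mul, neg_mul,
    neg_mul, neg_neg, neg_neg, ← mul_neg, expPeriod_natCast_mul, expPeriod_natCast_mul,
    expPeriod_natCast_mul, expPeriod_add, mul_pow, Nat.cast_succ]
  have := one_sub_pow_succ_ne_zero hb n
  have ha' := one_sub_pow_succ_ne_zero ha n
  have hA : expPeriod (o k) (-o a) ^ (n + 1) ≠ 0 := pow_ne_zero _ (expPeriod_ne_zero _ _)
  have : (n : ℂ) + 1 ≠ 0 := n.cast_add_one_ne_zero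
  rw [show expPeriod (o k) (o a) = (expPeriod (o k) (-o a))⁻¹ by rw [← expPeriod_neg, neg_neg],
    inv_pow, show 1 - (expPeriod (o k) (-o a) ^ (n + 1))⁻¹ =
      -((1 - expPeriod (o k) (-o a) ^ (n + 1)) / expPeriod (o k) (-o a) ^ (n + 1)) by
    field_simp; ring]
  field_simp

theorem exists_hasProd_hasSum_poleResidue (hab : a ≠ b) (hk : Finset.univ.erase k = {a, b})
    (ha : (o a / o k).im < 0) (hb : 0 < (o b / o k).im)
    (hz : 0 < ((z + o b) / o k).im) (hz' : 0 < ((-z - o a) / o k).im) :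
    ∃ S T, HasProd (fun p : ℕ × ℕ =>
        1 - expPeriod (o k) (z - p.1 * o a + (p.2 + 1) * o b)) (exp (-S)) ∧
      HasProd (fun p : ℕ × ℕ =>
        1 - expPeriod (o k) (-z + p.1 * o b - (p.2 + 1) * o a)) (exp (-T)) ∧
      HasSum (fun j : ℤ => 2 * Real.pi * I * poleResidue o z k j) (T - S) := by
  have lt_a : ‖expPeriod (o k) (-o a)‖ < 1 :=
    norm_expPeriod_lt_one (by rwa [neg_div, neg_im, neg_pos])
  have lt_b : ‖expPeriod (o k) (o b)‖ < 1 := norm_expPeriod_lt_one hb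
  obtain ⟨S, sum_S, prod_S⟩ :=
    exists_hasProd_one_sub_mul_pow (norm_expPeriod_lt_one hz) lt_a lt_b
  obtain ⟨T, sum_T, prod_T⟩ :=
    exists_hasProd_one_sub_mul_pow (norm_expPeriod_lt_one hz') lt_b lt_a
  refine ⟨S, T, prod_S.congr_fun fun p => ?_, prod_T.congr_fun fun p => ?_, ?_⟩
  · simp only [← expPeriod_natCast_mul, ← expPeriod_add]
    congr 2
    ring
  · simp only [← expPeriod_natCast_mul, ← expPeriod_add]
    congr 2
    ring
  have sum_nonneg : HasSum (fun n : ℕ => 2 * Real.pi * I * poleResidue o z k n) (-S) := by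
    rw [← hasSum_nat_add_iff' 1]
    have zero_term : ∑ i ∈ Finset.range 1, 2 * Real.pi * I * poleResidue o z k (i : ℕ) = 0 := by
      simp [poleResidue]
    simp only [two_pi_I_mul_poleResidue_succ hab hk lt_a lt_b, zero_term, sub_zero]
    exact sum_S.neg
  have sum_neg : HasSum (fun n : ℕ => 2 * Real.pi * I * poleResidue o z k (-(n + 1))) T := by
    simp only [two_pi_I_mul_poleResidue_neg_succ hab hk lt_a lt_b, ← sub_eq_add_neg]
    exact sum_T
  rw [sub_eq_neg_add]
  exact HasSum.of_nat_of_neg_add_one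
    (f := fun j : ℤ => 2 * Real.pi * I * poleResidue o z k j) sum_nonneg sum_neg

end DoubleProducts

section BernoulliThree

/-- The homogeneous polynomial `-B(-z | o) / 6`, where `B` is the triple Bernoulli polynomial
`B_{3,3}` multiplied by `o 0 * o 1 * o 2`. It is defined over any `ℚ`-algebra, because it is needed
both as a function and as an element of `ℚ(x₁, x₂, x₃)[w]`. -/
def bernoulliThree {R : Type*} [CommRing R] [Algebra ℚ R] (o : Fin 3 → R) (z : R) : R :=
  algebraMap ℚ R (1 / 6) * z ^ 3 + algebraMap ℚ R (1 / 4) * (o 0 + o 1 + o 2) * z ^ 2 +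
    algebraMap ℚ R (1 / 12) * (o 0 ^ 2 + o 1 ^ 2 + o 2 ^ 2 +
      3 * (o 0 * o 1 + o 0 * o 2 + o 1 * o 2)) * z +
    algebraMap ℚ R (1 / 24) * ((o 0 + o 1 + o 2) * (o 0 * o 1 + o 0 * o 2 + o 1 * o 2))

theorem coeff_toddSeries (ω : ℂ) (n : ℕ) :
    PowerSeries.coeff n (toddSeries ω) = ω⁻¹ * (ω ^ n * (bernoulli' n / n.factorial)) := by
  simp [toddSeries, bernoulli'PowerSeries]

theorem originResidue_fin_three {o : Fin 3 → ℂ} (ho : ∀ k, o k ≠ 0) (z : ℂ) :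
    originResidue o z = bernoulliThree o z / ∏ k, o k := by
  have h0 := ho 0
  have h1 := ho 1
  have h2 := ho 2
  simp [originResidue, Fin.prod_univ_three, PowerSeries.coeff_mul, coeff_toddSeries,
    Finset.Nat.antidiagonal_succ, bernoulliThree, Nat.factorial]
  field_simp
  ring

end BernoulliThree

section Lattice

open scoped Matrix

theorem IsPrimitive.neg {M : Type*} [AddCommGroup M] {v : M} (hv : IsPrimitive v) :
    IsPrimitive (-v) := by
  rintro k ⟨u, hu⟩
  exact hv k ⟨-u, by rw [smul_neg, ← hu, neg_neg]⟩

theorem IsPrimitive.ne_zero {M : Type*} [AddCommGroup M] {v : M} (hv : IsPrimitive v) :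
    v ≠ 0 := by
  rintro rfl
  simpa using hv 0 ⟨0, (smul_zero _).symm⟩

theorem IsPrimitive.exists_dotProduct_eq_one {ι : Type*} [Fintype ι] {a : ι → ℤ}
    (ha : IsPrimitive a) : ∃ y, a ⬝ᵥ y = 1 := by
  obtain ⟨f, hf⟩ := Finset.gcd_eq_sum_mul Finset.univ a
  have gcd_eq : Finset.univ.gcd a = 1 ∨ Finset.univ.gcd a = -1 :=
    ha _ ⟨fun i => a i / Finset.univ.gcd a, funext fun i =>
      (Int.mul_ediv_cancel' (Finset.gcd_dvd (Finset.mem_univ i))).symm⟩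
  have dot_eq : a ⬝ᵥ f = Finset.univ.gcd a := hf.symm
  rcases gcd_eq with h | h
  · exact ⟨f, dot_eq.trans h⟩
  · exact ⟨-f, by rw [dotProduct_neg, dot_eq, h, neg_neg]⟩

variable {a b : Fin 3 → ℤ}

theorem eq_smul_of_cross_eq_zero {R : Type*} [CommRing R] {a b y : Fin 3 → R} (hy : a ⬝ᵥ y = 1)
    (h : a ⨯₃ b = 0) : b = (y ⬝ᵥ b) • a := by
  have := cross_cross_eq_smul_sub_smul' y a b
  rw [h, map_zero, hy, one_smul] at this
  exact (sub_eq_zero.1 this.symm).symm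

theorem IsPrimitive.eq_or_eq_neg (ha : IsPrimitive a) (hb : IsPrimitive b) (h : a ⨯₃ b = 0) :
    b = a ∨ b = -a := by
  obtain ⟨y, hy⟩ := ha.exists_dotProduct_eq_one
  have b_eq := eq_smul_of_cross_eq_zero hy h
  rcases hb _ ⟨a, b_eq⟩ with h1 | h1 <;> rw [h1] at b_eq
  · exact Or.inl (b_eq.trans (one_smul _ _))
  · exact Or.inr (b_eq.trans (neg_one_smul _ _))

theorem IsPrimitive.eq_of_smul_eq_smul (ha : IsPrimitive a) (hb : IsPrimitive b) {s t : ℤ}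
    (hs : 0 < s) (ht : 0 < t) (h : s • a = t • b) : a = b := by
  have cross_eq_zero : a ⨯₃ b = 0 := by
    refine (smul_eq_zero.1 (?_ : s • (a ⨯₃ b) = 0)).resolve_left hs.ne'
    rw [← LinearMap.smul_apply, ← map_smul, h, map_smul, LinearMap.smul_apply, cross_self,
      smul_zero]
  rcases ha.eq_or_eq_neg hb cross_eq_zero with hba | hba
  · exact hba.symm
  · rw [hba, smul_neg, ← neg_smul] at h
    have : s = -t := smul_left_injective ℤ ha.ne_zero h
    lia

theorem linearIndependent_of_cross_ne_zero (h : a ⨯₃ b ≠ 0) : LinearIndependent ℤ ![a, b] := by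
  refine LinearIndependent.pair_iff.2 fun s t hst => ⟨?_, ?_⟩
  · simpa [h, -zsmul_eq_mul] using congrArg (· ⨯₃ b) hst
  · simpa [h, -zsmul_eq_mul] using congrArg (a ⨯₃ ·) hst

theorem cross_swap_ne_zero (h : a ⨯₃ b ≠ 0) : b ⨯₃ a ≠ 0 := by
  rwa [← cross_anticomm, neg_ne_zero]

theorem directionVector_isPrimitive (h : a ⨯₃ b ≠ 0) : IsPrimitive (directionVector a b) :=
  (directionVector_spec a b (linearIndependent_of_cross_ne_zero h)).1

theorem exists_cross_eq_smul (h : a ⨯₃ b ≠ 0) :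
    ∃ s : ℤ, 0 < s ∧ a ⨯₃ b = s • directionVector a b := by
  obtain ⟨-, s, hs, det_eq⟩ := directionVector_spec a b (linearIndependent_of_cross_ne_zero h)
  refine ⟨s, hs, funext fun i => ?_⟩
  simpa only [det_eq_cross, dotProduct_single_one, Pi.smul_apply, smul_eq_mul] using
    det_eq (Pi.single i 1)

theorem directionVector_eq {γ : Fin 3 → ℤ} (h : a ⨯₃ b ≠ 0) (hγ : IsPrimitive γ) {s t : ℤ}
    (hs : 0 < s) (ht : 0 < t) (he : s • (a ⨯₃ b) = t • γ) : directionVector a b = γ := by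
  obtain ⟨r, hr, cross_eq⟩ := exists_cross_eq_smul h
  rw [cross_eq, smul_smul] at he
  exact (directionVector_isPrimitive h).eq_of_smul_eq_smul hγ (mul_pos hs hr) ht he

theorem directionVector_swap (h : a ⨯₃ b ≠ 0) : directionVector b a = -directionVector a b := by
  obtain ⟨s, hs, cross_eq⟩ := exists_cross_eq_smul h
  refine directionVector_eq (cross_swap_ne_zero h) (directionVector_isPrimitive h).neg one_pos hs ?_
  rw [one_smul, ← cross_anticomm, cross_eq, smul_neg]

theorem directionVector_dot_left (h : a ⨯₃ b ≠ 0) : directionVector a b ⬝ᵥ a = 0 := by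
  obtain ⟨s, hs, cross_eq⟩ := exists_cross_eq_smul h
  have := dot_self_cross a b
  rw [cross_eq, dotProduct_smul, dotProduct_comm] at this
  exact (smul_eq_zero.1 this).resolve_left hs.ne'

theorem directionVector_dot_right (h : a ⨯₃ b ≠ 0) : directionVector a b ⬝ᵥ b = 0 := by
  rw [← neg_eq_zero, ← neg_dotProduct, ← directionVector_swap h]
  exact directionVector_dot_left (cross_swap_ne_zero h)

theorem mem_zmultiples_directionVector {δ : Fin 3 → ℤ} (h : a ⨯₃ b ≠ 0) (ha : δ ⬝ᵥ a = 0)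
    (hb : δ ⬝ᵥ b = 0) : δ ∈ AddSubgroup.zmultiples (directionVector a b) := by
  obtain ⟨s, hs, cross_eq⟩ := exists_cross_eq_smul h
  obtain ⟨y, hy⟩ := (directionVector_isPrimitive h).exists_dotProduct_eq_one
  have cross_eq_zero : directionVector a b ⨯₃ δ = 0 := by
    have := cross_cross_eq_smul_sub_smul' δ a b
    rw [dotProduct_comm a, ha, hb, zero_smul, zero_smul, sub_zero, cross_eq, map_smul] at this
    rw [← cross_anticomm, neg_eq_zero]
    exact (smul_eq_zero.1 this).resolve_left hs.ne'
  exact AddSubgroup.mem_zmultiples_iff.2 ⟨_, (eq_smul_of_cross_eq_zero hy cross_eq_zero).symm⟩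

end Lattice

section Weight

open scoped Matrix

section FormEval

variable {R : Type*} [CommRing R] [Algebra R ℂ] (a b : Fin 3 → R) (x : Fin 3 → ℂ)

theorem formEval_add : formEval (a + b) x = formEval a x + formEval b x := by
  simp only [formEval, Pi.add_apply, map_add, add_mul, Finset.sum_add_distrib]

theorem formEval_neg : formEval (-a) x = -formEval a x := by
  simp only [formEval, Pi.neg_apply, map_neg, neg_mul, Finset.sum_neg_distrib]

theorem formEval_sub : formEval (a - b) x = formEval a x - formEval b x := by
  rw [sub_eq_add_neg, formEval_add, formEval_neg, sub_eq_add_neg]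

theorem formEval_zsmul (n : ℤ) : formEval (n • a) x = n * formEval a x := by
  simp only [formEval, Pi.smul_apply, zsmul_eq_mul, map_mul, map_intCast, Finset.mul_sum,
    mul_assoc]

end FormEval

/-- The pairing of `a` with the vector product of the imaginary and real parts of `x`. For
primitive `a` it is positive if `x` lies in `U_a^+`. -/
def weight {R : Type*} [CommRing R] [Algebra R ℝ] (a : Fin 3 → R) (x : Fin 3 → ℂ) : ℝ :=
  (fun i => algebraMap R ℝ (a i)) ⬝ᵥ ((fun i => (x i).im) ⨯₃ (fun i => (x i).re))

section CommRing

variable {R : Type*} [CommRing R] [Algebra R ℝ]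

theorem weight_add (a b : Fin 3 → R) (x : Fin 3 → ℂ) :
    weight (a + b) x = weight a x + weight b x := by
  simp only [weight, ← add_dotProduct]
  exact congrArg (· ⬝ᵥ _) (funext fun i => map_add _ _ _)

theorem weight_neg (a : Fin 3 → R) (x : Fin 3 → ℂ) : weight (-a) x = -weight a x := by
  simp only [weight, ← neg_dotProduct]
  exact congrArg (· ⬝ᵥ _) (funext fun i => map_neg _ _)

theorem weight_sub (a b : Fin 3 → R) (x : Fin 3 → ℂ) :
    weight (a - b) x = weight a x - weight b x := by
  rw [sub_eq_add_neg, weight_add, weight_neg, sub_eq_add_neg]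

theorem weight_smul (r : R) (a : Fin 3 → R) (x : Fin 3 → ℂ) :
    weight (r • a) x = algebraMap R ℝ r * weight a x := by
  simp only [weight, ← smul_eq_mul, ← smul_dotProduct]
  exact congrArg (· ⬝ᵥ _) (funext fun i => map_mul _ _ _)

theorem im_formEval_mul_conj [Algebra R ℂ] [IsScalarTower R ℝ ℂ] (α β : Fin 3 → R)
    (x : Fin 3 → ℂ) :
    (formEval α x * (starRingEnd ℂ) (formEval β x)).im = weight (α ⨯₃ β) x := by
  simp [formEval, weight, cross_apply, dotProduct, Fin.sum_univ_three,
    IsScalarTower.algebraMap_apply R ℝ ℂ]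
  ring

end CommRing

variable {a b : Fin 3 → ℤ} {x : Fin 3 → ℂ}

theorem weight_pos (ha : a ≠ 0) (hx : x ∈ UPlus a) : 0 < weight a x := by
  obtain ⟨α, β, ⟨hα, hβ, -, oriented⟩, im_pos⟩ := hx
  set A : Fin 3 → ℚ := fun i => a i with hA
  have A_ne_zero : A ≠ 0 := fun h => ha (funext fun i => by simpa [hA] using congrFun h i)
  have dot_pos : 0 < A ⬝ᵥ A := by
    simpa only [star_trivial] using Matrix.dotProduct_self_star_pos_iff.2 A_ne_zero
  have det_pos : 0 < A ⬝ᵥ (α ⨯₃ β) := by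
    rw [triple_product_permutation, triple_product_eq_det]
    exact oriented A dot_pos
  have cross_parallel : (A ⬝ᵥ A) • (α ⨯₃ β) = (A ⬝ᵥ (α ⨯₃ β)) • A := by
    have cross_eq_zero : A ⨯₃ (α ⨯₃ β) = 0 := by
      rw [cross_cross_eq_smul_sub_smul', hα, dotProduct_comm, hβ, zero_smul, zero_smul, sub_zero]
    have := cross_cross_eq_smul_sub_smul' A A (α ⨯₃ β)
    rw [cross_eq_zero, map_zero] at this
    exact (sub_eq_zero.1 this.symm).symm
  have weight_eq : ((A ⬝ᵥ A : ℚ) : ℝ) * (formEval α x * (starRingEnd ℂ) (formEval β x)).im =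
      ((A ⬝ᵥ (α ⨯₃ β) : ℚ) : ℝ) * weight a x := by
    have weight_A : weight A x = weight a x := by simp [weight, hA]
    rw [im_formEval_mul_conj, ← weight_A, ← eq_ratCast (algebraMap ℚ ℝ), ← weight_smul,
      cross_parallel, weight_smul, eq_ratCast]
  have : 0 < ((A ⬝ᵥ (α ⨯₃ β) : ℚ) : ℝ) * weight a x :=
    weight_eq ▸ mul_pos (Rat.cast_pos.2 dot_pos) im_pos
  exact (mul_pos_iff_of_pos_left (Rat.cast_pos.2 det_pos)).1 this

theorem im_formEval_mul_conj_directionVector {s : ℤ} (hs : a ⨯₃ b = s • directionVector a b)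
    (δ : Fin 3 → ℤ) (x : Fin 3 → ℂ) :
    s * (formEval δ x * (starRingEnd ℂ) (formEval (directionVector a b) x)).im =
      (δ ⬝ᵥ b : ℤ) * weight a x - (δ ⬝ᵥ a : ℤ) * weight b x := by
  rw [im_formEval_mul_conj, ← eq_intCast (algebraMap ℤ ℝ) s, ← weight_smul, ← map_smul, ← hs,
    cross_cross_eq_smul_sub_smul', weight_sub, weight_smul, weight_smul, dotProduct_comm a]
  rfl

theorem formEval_directionVector_ne_zero (h : a ⨯₃ b ≠ 0) (hb : 0 < weight b x) :
    formEval (directionVector a b) x ≠ 0 := by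
  intro h0
  obtain ⟨s, -, cross_eq⟩ := exists_cross_eq_smul h
  have := im_formEval_mul_conj_directionVector cross_eq (b ⨯₃ (a ⨯₃ b)) x
  rw [h0, dotProduct_comm _ b, dot_self_cross, dotProduct_comm _ a, triple_product_permutation,
    triple_product_permutation] at this
  simp [hb.ne', h] at this

theorem exists_im_formEval_div (h : a ⨯₃ b ≠ 0) (hb : 0 < weight b x) :
    ∃ c > 0, ∀ δ : Fin 3 → ℤ, (formEval δ x / formEval (directionVector a b) x).im =
      c * weight a x * (δ ⬝ᵥ b : ℤ) - c * weight b x * (δ ⬝ᵥ a : ℤ) := by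
  obtain ⟨s, hs, cross_eq⟩ := exists_cross_eq_smul h
  set γ := formEval (directionVector a b) x
  have normSq_pos : 0 < Complex.normSq γ :=
    Complex.normSq_pos.2 (formEval_directionVector_ne_zero h hb)
  have : (0 : ℝ) < s := Int.cast_pos.2 hs
  refine ⟨(s * Complex.normSq γ)⁻¹, by positivity, fun δ => ?_⟩
  have im_div : (formEval δ x / γ).im =
      (formEval δ x * (starRingEnd ℂ) γ).im / Complex.normSq γ := by
    rw [div_eq_mul_inv, Complex.inv_def, ← mul_assoc, Complex.im_mul_ofReal, div_eq_mul_inv]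
  rw [im_div]
  field_simp
  linear_combination im_formEval_mul_conj_directionVector cross_eq δ x

end Weight

section WedgeProduct

open Filter Topology Complex
open scoped Matrix

theorem factor_mk (ε : ℤ) (γ δ : Fin 3 → ℤ) (w : ℂ) (x : Fin 3 → ℂ) :
    factor ε γ w x (QuotientAddGroup.mk δ) =
      1 - expPeriod (formEval γ x) (ε * (formEval δ x - w)) := by
  rw [expPeriod, ← mul_assoc, mul_comm _ (ε : ℂ)]
  rfl

theorem factor_sub_one (ε : ℤ) (γ : Fin 3 → ℤ) (w : ℂ) (x : Fin 3 → ℂ)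
    (q : (Fin 3 → ℤ) ⧸ AddSubgroup.zmultiples γ) :
    factor ε γ w x q - 1 = (factor ε γ 0 x q - 1) * expPeriod (formEval γ x) (-(ε * w)) := by
  obtain ⟨δ, rfl⟩ := QuotientAddGroup.mk_surjective q
  rw [factor_mk, factor_mk, mul_sub, sub_eq_add_neg (_ * _), expPeriod_add, sub_zero]
  ring

theorem differentiable_factor (ε : ℤ) (γ : Fin 3 → ℤ) (x : Fin 3 → ℂ)
    (q : (Fin 3 → ℤ) ⧸ AddSubgroup.zmultiples γ) : Differentiable ℂ fun w => factor ε γ w x q := by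
  obtain ⟨δ, rfl⟩ := QuotientAddGroup.mk_surjective q
  simp only [factor_mk, expPeriod]
  fun_prop

/-- The infinite product over `cone a b / ℤγ` of the factors with sign `ε`. Numerator and
denominator of `Γ_{a,b}` are such products with opposite signs and with `a` and `b` swapped. -/
def wedgeProd (ε : ℤ) (a b γ : Fin 3 → ℤ) (x : Fin 3 → ℂ) (w : ℂ) : ℂ :=
  ∏' q : orbits (cone a b) γ, factor ε γ w x q

/-- The form `γ` spans the forms vanishing at `a` and `b`, and `ε δ(x) / γ(x)` has an imaginary part
which makes the product `wedgeProd ε a b γ x` converge. -/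
structure Admissible (ε : ℤ) (a b γ : Fin 3 → ℤ) (x : Fin 3 → ℂ) : Prop where
  sq_eq_one : ε * ε = 1
  dot_left : γ ⬝ᵥ a = 0
  dot_right : γ ⬝ᵥ b = 0
  mem_zmultiples : ∀ δ, δ ⬝ᵥ a = 0 → δ ⬝ᵥ b = 0 → δ ∈ AddSubgroup.zmultiples γ
  ne_zero : formEval γ x ≠ 0
  exists_im : ∃ A > 0, ∃ B > 0, ∀ δ : Fin 3 → ℤ, ε * (formEval δ x / formEval γ x).im =
    A * (δ ⬝ᵥ a : ℤ) - B * (δ ⬝ᵥ b : ℤ)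

variable {ε : ℤ} {a b γ : Fin 3 → ℤ} {x : Fin 3 → ℂ}

theorem admissible_num (h : a ⨯₃ b ≠ 0) (ha : 0 < weight a x) (hb : 0 < weight b x) :
    Admissible (-1) a b (directionVector a b) x where
  sq_eq_one := by norm_num
  dot_left := directionVector_dot_left h
  dot_right := directionVector_dot_right h
  mem_zmultiples _ := mem_zmultiples_directionVector h
  ne_zero := formEval_directionVector_ne_zero h hb
  exists_im := by
    obtain ⟨c, hc, im_eq⟩ := exists_im_formEval_div h hb
    refine ⟨c * weight b x, by positivity, c * weight a x, by positivity, fun δ => ?_⟩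
    rw [im_eq]
    push_cast
    ring

theorem admissible_den (h : a ⨯₃ b ≠ 0) (ha : 0 < weight a x) (hb : 0 < weight b x) :
    Admissible 1 b a (directionVector a b) x where
  sq_eq_one := by norm_num
  dot_left := directionVector_dot_right h
  dot_right := directionVector_dot_left h
  mem_zmultiples _ hδb hδa := mem_zmultiples_directionVector h hδa hδb
  ne_zero := formEval_directionVector_ne_zero h hb
  exists_im := by
    obtain ⟨c, hc, im_eq⟩ := exists_im_formEval_div h hb
    refine ⟨c * weight a x, by positivity, c * weight b x, by positivity, fun δ => ?_⟩
    rw [im_eq]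
    push_cast
    ring

namespace Admissible

theorem mk_eq_mk (h : Admissible ε a b γ x) {δ δ' : Fin 3 → ℤ} (ha : δ ⬝ᵥ a = δ' ⬝ᵥ a)
    (hb : δ ⬝ᵥ b = δ' ⬝ᵥ b) :
    (QuotientAddGroup.mk δ : (Fin 3 → ℤ) ⧸ AddSubgroup.zmultiples γ) = QuotientAddGroup.mk δ' := by
  rw [QuotientAddGroup.eq]
  refine h.mem_zmultiples _ ?_ ?_
  · rw [add_dotProduct, neg_dotProduct, ha, neg_add_cancel]
  · rw [add_dotProduct, neg_dotProduct, hb, neg_add_cancel]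

theorem add_zsmul_mem_cone (h : Admissible ε a b γ x) {δ : Fin 3 → ℤ} (hδ : δ ∈ cone a b) (n : ℤ) :
    δ + n • γ ∈ cone a b := by
  simpa only [cone, Set.mem_ofPred_eq, add_dotProduct, smul_dotProduct, h.dot_left, h.dot_right,
    smul_zero, add_zero] using hδ

theorem exists_eq_formEval_of_factor_eq_zero (h : Admissible ε a b γ x)
    {q : (Fin 3 → ℤ) ⧸ AddSubgroup.zmultiples γ} (hq : q ∈ orbits (cone a b) γ) {w : ℂ}
    (h0 : factor ε γ w x q = 0) : ∃ δ ∈ cone a b, w = formEval δ x := by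
  obtain ⟨δ, hδ, rfl⟩ := hq
  obtain ⟨n, hn⟩ := exp_eq_one_iff.1 (sub_eq_zero.1 h0).symm
  have := h.ne_zero
  have : (Real.pi : ℂ) ≠ 0 := ofReal_ne_zero.2 Real.pi_ne_zero
  have sq_eq_one : (ε : ℂ) * ε = 1 := mod_cast h.sq_eq_one
  refine ⟨δ + (-(ε * n)) • γ, h.add_zsmul_mem_cone hδ _, ?_⟩
  rw [formEval_add, formEval_zsmul]
  field_simp at hn
  push_cast
  linear_combination (-(ε : ℂ)) * hn + (formEval δ x - w) * sq_eq_one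

theorem exists_norm_factor_zero_sub_one (h : Admissible ε a b γ x) :
    ∃ r ∈ Set.Ico (0 : ℝ) 1, ∃ s ∈ Set.Ico (0 : ℝ) 1, ∀ δ ∈ cone a b,
      ‖factor ε γ 0 x (QuotientAddGroup.mk δ) - 1‖ =
        r ^ (δ ⬝ᵥ a).toNat * s ^ (-(δ ⬝ᵥ b)).toNat := by
  obtain ⟨A, hA, B, hB, im_eq⟩ := h.exists_im
  have exp_mem : ∀ {C : ℝ}, 0 < C → Real.exp (-(2 * Real.pi * C)) ∈ Set.Ico (0 : ℝ) 1 := fun hC =>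
    ⟨Real.exp_nonneg _, Real.exp_lt_one_iff.2 (neg_lt_zero.2 (by positivity))⟩
  refine ⟨_, exp_mem hA, _, exp_mem hB, fun δ hδ => ?_⟩
  have im_eq' : ((ε * formEval δ x) / formEval γ x).im =
      A * (δ ⬝ᵥ a).toNat + B * (-(δ ⬝ᵥ b)).toNat := by
    have toNat_left : ((δ ⬝ᵥ a).toNat : ℝ) = (δ ⬝ᵥ a : ℤ) :=
      mod_cast Int.toNat_of_nonneg hδ.1.le
    have toNat_right : ((-(δ ⬝ᵥ b)).toNat : ℝ) = -(δ ⬝ᵥ b : ℤ) :=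
      mod_cast Int.toNat_of_nonneg (neg_nonneg.2 hδ.2)
    rw [mul_div_assoc, ← ofReal_intCast, im_ofReal_mul, im_eq, toNat_left, toNat_right]
    ring
  rw [factor_mk, sub_zero, sub_sub_cancel_left, norm_neg, norm_expPeriod, im_eq',
    ← Real.exp_nat_mul, ← Real.exp_nat_mul, ← Real.exp_add]
  congr 1
  ring

theorem summable_norm_factor_zero_sub_one (h : Admissible ε a b γ x) :
    Summable fun q : orbits (cone a b) γ => ‖factor ε γ 0 x q - 1‖ := by
  obtain ⟨r, hr, s, hs, norm_eq⟩ := h.exists_norm_factor_zero_sub_one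
  choose δ hδ hq using fun q : orbits (cone a b) γ => q.2
  have geometric : Summable fun p : ℕ × ℕ => r ^ p.1 * s ^ p.2 :=
    (summable_geometric_of_lt_one hr.1 hr.2).mul_of_nonneg
      (summable_geometric_of_lt_one hs.1 hs.2) (fun n => pow_nonneg hr.1 n)
      fun n => pow_nonneg hs.1 n
  have injective : Function.Injective fun q : orbits (cone a b) γ =>
      ((δ q ⬝ᵥ a).toNat, (-(δ q ⬝ᵥ b)).toNat) := fun q q' hqq => by
    have left_eq : δ q ⬝ᵥ a = δ q' ⬝ᵥ a := by
      rw [← Int.toNat_of_nonneg (hδ q).1.le, ← Int.toNat_of_nonneg (hδ q').1.le]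
      exact congrArg Nat.cast (congrArg Prod.fst hqq)
    have right_eq : -(δ q ⬝ᵥ b) = -(δ q' ⬝ᵥ b) := by
      rw [← Int.toNat_of_nonneg (neg_nonneg.2 (hδ q).2),
        ← Int.toNat_of_nonneg (neg_nonneg.2 (hδ q').2)]
      exact congrArg Nat.cast (congrArg Prod.snd hqq)
    exact Subtype.ext ((hq q).symm.trans ((h.mk_eq_mk left_eq (neg_inj.1 right_eq)).trans (hq q')))
  refine (geometric.comp_injective injective).congr fun q => ?_
  rw [← hq q, norm_eq _ (hδ q)]
  rfl

theorem summable_norm (h : Admissible ε a b γ x) (w : ℂ) :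
    Summable fun q : orbits (cone a b) γ => ‖factor ε γ w x q - 1‖ := by
  simp only [factor_sub_one ε γ w, norm_mul]
  exact h.summable_norm_factor_zero_sub_one.mul_right _

theorem multipliable (h : Admissible ε a b γ x) (w : ℂ) :
    Multipliable fun q : orbits (cone a b) γ => factor ε γ w x q := by
  simpa only [add_sub_cancel] using multipliable_one_add_of_summable (h.summable_norm w)

theorem wedgeProd_ne_zero (h : Admissible ε a b γ x) {w : ℂ}
    (hw : ∀ δ ∈ cone a b, w ≠ formEval δ x) : wedgeProd ε a b γ x w ≠ 0 := by
  have factor_ne_zero : ∀ q : orbits (cone a b) γ, 1 + (factor ε γ w x q - 1) ≠ 0 := fun q h0 => by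
    rw [add_sub_cancel] at h0
    obtain ⟨δ, hδ, w_eq⟩ := h.exists_eq_formEval_of_factor_eq_zero q.2 h0
    exact hw δ hδ w_eq
  simpa only [wedgeProd, add_sub_cancel] using
    tprod_one_add_ne_zero_of_summable factor_ne_zero (h.summable_norm w)

theorem differentiable (h : Admissible ε a b γ x) : Differentiable ℂ (wedgeProd ε a b γ x) := by
  intro w₀
  obtain ⟨M, hM⟩ := (isCompact_closedBall w₀ 1).exists_bound_of_continuousOn
    (f := fun w => expPeriod (formEval γ x) (-(ε * w))) (by unfold expPeriod; fun_prop)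
  have product := (h.summable_norm_factor_zero_sub_one.mul_right
      M).hasProdLocallyUniformlyOn_one_add
    (f := fun (q : orbits (cone a b) γ) w => factor ε γ w x q - 1) Metric.isOpen_ball
    (Eventually.of_forall fun q w hw => by
      rw [factor_sub_one, norm_mul]
      exact mul_le_mul_of_nonneg_left (hM w (Metric.ball_subset_closedBall hw)) (norm_nonneg _))
    fun q => ((differentiable_factor ε γ x q).continuous.sub continuous_const).continuousOn
  have diff_on := product.differentiableOn (Eventually.of_forall fun S => by
      simpa only [add_sub_cancel] using (Differentiable.fun_finsetProd (u := S)
        fun (q : orbits (cone a b) γ) _ => differentiable_factor ε γ x q).differentiableOn)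
      Metric.isOpen_ball
  simp only [add_sub_cancel] at diff_on
  exact (diff_on w₀ (Metric.mem_ball_self one_pos)).differentiableAt
    (Metric.isOpen_ball.mem_nhds (Metric.mem_ball_self one_pos))

end Admissible

theorem wedgeProd_formEval_eq_zero {δ : Fin 3 → ℤ} (hδ : δ ∈ cone a b) :
    wedgeProd ε a b γ x (formEval δ x) = 0 :=
  tprod_of_exists_eq_zero ⟨⟨_, δ, hδ, rfl⟩, by simp [factor_mk, expPeriod]⟩

theorem wedgeProd_neg (ε : ℤ) (a b γ : Fin 3 → ℤ) (x : Fin 3 → ℂ) (w : ℂ) :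
    wedgeProd (-ε) a b (-γ) x w = wedgeProd ε a b γ x w := by
  set e := QuotientAddGroup.quotientAddEquivOfEq (AddSubgroup.zmultiples_neg (g := γ)).symm
  have mem_orbits : ∀ q, q ∈ orbits (cone a b) γ ↔ e q ∈ orbits (cone a b) (-γ) := fun q => by
    refine ⟨?_, ?_⟩
    · rintro ⟨δ, hδ, rfl⟩
      exact ⟨δ, hδ, rfl⟩
    · rintro ⟨δ, hδ, hq⟩
      exact ⟨δ, hδ, e.injective hq⟩
  rw [wedgeProd, wedgeProd, ← (e.toEquiv.subtypeEquiv mem_orbits).tprod_eq]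
  refine tprod_congr fun ⟨_, δ, hδ, rfl⟩ => ?_
  change factor (-ε) (-γ) w x (QuotientAddGroup.mk δ) = factor ε γ w x (QuotientAddGroup.mk δ)
  rw [factor_mk, factor_mk, formEval_neg, expPeriod, expPeriod, div_neg, Int.cast_neg, neg_mul,
    mul_neg, neg_div, neg_neg]

end WedgeProduct

section TwoTermRelation

open Filter Topology Complex
open scoped Matrix

variable {a b : Fin 3 → ℤ} {x : Fin 3 → ℂ}

theorem countable_zerosPoles (a b : Fin 3 → ℤ) (x : Fin 3 → ℂ) : (zerosPoles a b x).Countable := by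
  refine (Set.countable_range fun δ : Fin 3 → ℤ => formEval δ x).mono ?_
  rintro w ⟨δ, -, rfl⟩
  exact ⟨δ, rfl⟩

theorem cone_self (a : Fin 3 → ℤ) : cone a a = ∅ :=
  Set.eq_empty_of_forall_notMem fun _ hδ => hδ.1.not_ge hδ.2

theorem zerosPoles_self (a : Fin 3 → ℤ) (x : Fin 3 → ℂ) : zerosPoles a a x = ∅ := by
  simp [zerosPoles, cone_self]

theorem zerosPoles_swap (a b : Fin 3 → ℤ) (x : Fin 3 → ℂ) :
    zerosPoles b a x = zerosPoles a b x := by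
  rw [zerosPoles, zerosPoles, Set.union_comm]

theorem eq_or_cross_ne_zero (ha : IsPrimitive a) (hb : IsPrimitive b) (hxa : 0 < weight a x)
    (hxb : 0 < weight b x) : b = a ∨ a ⨯₃ b ≠ 0 := by
  refine or_iff_not_imp_right.2 fun h => (ha.eq_or_eq_neg hb (not_not.1 h)).resolve_right ?_
  rintro rfl
  rw [weight_neg] at hxb
  linarith

theorem Gam_self (a : Fin 3 → ℤ) (w : ℂ) (x : Fin 3 → ℂ) : Gam a a w x = 1 := if_pos rfl

theorem Gam_eq_div (h : a ⨯₃ b ≠ 0) (w : ℂ) (x : Fin 3 → ℂ) :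
    Gam a b w x = wedgeProd (-1) a b (directionVector a b) x w /
      wedgeProd 1 b a (directionVector a b) x w :=
  if_neg (by rintro rfl; exact h (cross_self a))

theorem Gam_swap (h : a ⨯₃ b ≠ 0) (w : ℂ) (x : Fin 3 → ℂ) : Gam b a w x = (Gam a b w x)⁻¹ := by
  have num_eq := wedgeProd_neg (-1) a b (directionVector a b) x w
  rw [neg_neg] at num_eq
  rw [Gam_eq_div h, Gam_eq_div (cross_swap_ne_zero h), directionVector_swap h, inv_div, num_eq,
    wedgeProd_neg]

theorem wedgeProd_ne_zero_of_notMem (h : a ⨯₃ b ≠ 0) (ha : 0 < weight a x) (hb : 0 < weight b x)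
    {w : ℂ} (hw : w ∉ zerosPoles a b x) : wedgeProd (-1) a b (directionVector a b) x w ≠ 0 ∧
      wedgeProd 1 b a (directionVector a b) x w ≠ 0 :=
  ⟨(admissible_num h ha hb).wedgeProd_ne_zero fun δ hδ w_eq => hw ⟨δ, Or.inl hδ, w_eq⟩,
    (admissible_den h ha hb).wedgeProd_ne_zero fun δ hδ w_eq => hw ⟨δ, Or.inr hδ, w_eq⟩⟩

theorem Gam_ne_zero (h : a ⨯₃ b ≠ 0) (ha : 0 < weight a x) (hb : 0 < weight b x) {w : ℂ}
    (hw : w ∉ zerosPoles a b x) : Gam a b w x ≠ 0 := by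
  obtain ⟨num_ne, den_ne⟩ := wedgeProd_ne_zero_of_notMem h ha hb hw
  rw [Gam_eq_div h]
  exact div_ne_zero num_ne den_ne

theorem Gam_mul_Gam_swap (ha : IsPrimitive a) (hb : IsPrimitive b) (hxa : 0 < weight a x)
    (hxb : 0 < weight b x) {w : ℂ} (hw : w ∉ zerosPoles a b x) :
    Gam a b w x * Gam b a w x = 1 := by
  rcases eq_or_cross_ne_zero ha hb hxa hxb with rfl | h
  · rw [Gam_self, one_mul]
  · rw [Gam_swap h, mul_inv_cancel₀ (Gam_ne_zero h hxa hxb hw)]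

theorem multipliable_numFactor_and_denFactor (ha : IsPrimitive a) (hb : IsPrimitive b)
    (hxa : 0 < weight a x) (hxb : 0 < weight b x) (w : ℂ) :
    Multipliable (numFactor a b w x) ∧ Multipliable (denFactor a b w x) := by
  rcases eq_or_cross_ne_zero ha hb hxa hxb with rfl | h
  · have : IsEmpty (orbits (cone b b) (directionVector b b)) := by
      rw [cone_self, orbits, Set.image_empty]
      infer_instance
    exact ⟨multipliable_empty, multipliable_empty⟩
  · exact ⟨(admissible_num h hxa hxb).multipliable w, (admissible_den h hxa hxb).multipliable w⟩

theorem meromorphic_Gam (ha : IsPrimitive a) (hb : IsPrimitive b) (hxa : 0 < weight a x)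
    (hxb : 0 < weight b x) : Meromorphic fun w => Gam a b w x := by
  intro w
  rcases eq_or_cross_ne_zero ha hb hxa hxb with rfl | h
  · simp only [Gam_self]
    exact MeromorphicAt.const 1 w
  · simp only [Gam_eq_div h]
    exact ((admissible_num h hxa hxb).differentiable.analyticAt w).meromorphicAt.div
      ((admissible_den h hxa hxb).differentiable.analyticAt w).meromorphicAt

theorem compl_zerosPoles_mem_codiscrete (ha : IsPrimitive a) (hb : IsPrimitive b)
    (hxa : 0 < weight a x) (hxb : 0 < weight b x) : (zerosPoles a b x)ᶜ ∈ codiscrete ℂ := by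
  rcases eq_or_cross_ne_zero ha hb hxa hxb with rfl | h
  · rw [zerosPoles_self, Set.compl_empty]
    exact univ_mem
  set f : ℂ → ℂ := fun w => wedgeProd (-1) a b (directionVector a b) x w *
    wedgeProd 1 b a (directionVector a b) x w with hf
  have f_diff : Differentiable ℂ f :=
    (admissible_num h hxa hxb).differentiable.mul (admissible_den h hxa hxb).differentiable
  obtain ⟨w, hw⟩ := ((countable_zerosPoles a b x).dense_compl ℝ).nonempty
  obtain ⟨num_ne, den_ne⟩ := wedgeProd_ne_zero_of_notMem h hxa hxb hw
  have f_analytic : AnalyticOnNhd ℂ f Set.univ := fun u _ => f_diff.analyticAt u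
  refine mem_of_superset (f_analytic.preimage_zero_mem_codiscrete (mul_ne_zero num_ne den_ne)) ?_
  rintro u hu ⟨δ, hδ | hδ, rfl⟩ <;>
    exact hu (by simp [hf, wedgeProd_formEval_eq_zero hδ])

end TwoTermRelation

section CoplanarRelation

open scoped Matrix

variable {a b c : Fin 3 → ℤ} {x : Fin 3 → ℂ}

theorem cone_eq_union {n p q : ℤ} (hn : 0 < n) (hp : 0 < p) (hq : 0 < q)
    (h : n • b = p • a + q • c) : cone a c = cone a b ∪ cone b c := by
  ext δ
  have dot_eq : n * (δ ⬝ᵥ b) = p * (δ ⬝ᵥ a) + q * (δ ⬝ᵥ c) := by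
    simpa only [dotProduct_add, dotProduct_smul, smul_eq_mul] using congrArg (δ ⬝ᵥ ·) h
  simp only [cone, Set.mem_union, Set.mem_ofPred_eq]
  refine ⟨fun ⟨ha, hc⟩ => ?_, ?_⟩
  · exact (le_or_gt (δ ⬝ᵥ b) 0).imp (fun hb => ⟨ha, hb⟩) fun hb => ⟨hb, hc⟩
  · rintro (⟨ha, hb⟩ | ⟨hb, hc⟩)
    · exact ⟨ha, by_contra fun hc => by nlinarith [mul_pos hp ha, mul_pos hq (not_le.1 hc)]⟩
    · exact ⟨by_contra fun ha => by nlinarith [mul_pos hn hb], hc⟩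

theorem wedgeProd_mul_wedgeProd {ε : ℤ} {γ : Fin 3 → ℤ} (hab : Admissible ε a b γ x)
    (hbc : Admissible ε b c γ x) (cone_eq : cone a c = cone a b ∪ cone b c) (w : ℂ) :
    wedgeProd ε a b γ x w * wedgeProd ε b c γ x w = wedgeProd ε a c γ x w := by
  have disjoint : Disjoint (orbits (cone a b) γ) (orbits (cone b c) γ) := by
    rw [Set.disjoint_left]
    rintro _ ⟨δ, hδ, rfl⟩ ⟨δ', hδ', mk_eq⟩
    obtain ⟨n, hn⟩ := AddSubgroup.mem_zmultiples_iff.1 (QuotientAddGroup.eq.1 mk_eq)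
    have mem_cone := hbc.add_zsmul_mem_cone hδ' n
    rw [hn, add_neg_cancel_left] at mem_cone
    exact hδ.2.not_gt mem_cone.1
  have tprod_eq := Multipliable.tprod_union_disjoint (f := fun q => factor ε γ w x q) disjoint
    (hab.multipliable w) (hbc.multipliable w)
  rw [wedgeProd, wedgeProd, wedgeProd, ← tprod_eq, cone_eq, orbits, orbits, orbits, Set.image_union]

theorem Gam_mul_Gam_of_between {n p q : ℤ} (hn : 0 < n) (hp : 0 < p) (hq : 0 < q)
    (h : n • b = p • a + q • c) (hac : a ⨯₃ c ≠ 0) (hxa : 0 < weight a x) (hxb : 0 < weight b x)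
    (hxc : 0 < weight c x) (w : ℂ) : Gam a b w x * Gam b c w x = Gam a c w x := by
  have cross_left : n • (a ⨯₃ b) = q • (a ⨯₃ c) := by
    simpa only [map_smul, map_add, cross_self, smul_zero, zero_add] using congrArg (a ⨯₃ ·) h
  have cross_right : n • (b ⨯₃ c) = p • (a ⨯₃ c) := by
    simpa only [map_smul, map_add, LinearMap.smul_apply, LinearMap.add_apply, cross_self, smul_zero,
      add_zero] using congrArg (· ⨯₃ c) h
  have hab : a ⨯₃ b ≠ 0 := right_ne_zero_of_smul (cross_left ▸ smul_ne_zero hq.ne' hac)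
  have hbc : b ⨯₃ c ≠ 0 := right_ne_zero_of_smul (cross_right ▸ smul_ne_zero hp.ne' hac)
  obtain ⟨s, hs, cross_eq⟩ := exists_cross_eq_smul hac
  have hγ := directionVector_isPrimitive hac
  have direction_left : directionVector a b = directionVector a c :=
    directionVector_eq hab hγ hn (mul_pos hq hs) (by rw [cross_left, cross_eq, smul_smul])
  have direction_right : directionVector b c = directionVector a c :=
    directionVector_eq hbc hγ hn (mul_pos hp hs) (by rw [cross_right, cross_eq, smul_smul])
  have num_mul := wedgeProd_mul_wedgeProd (direction_left ▸ admissible_num hab hxa hxb)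
    (direction_right ▸ admissible_num hbc hxb hxc) (cone_eq_union hn hp hq h) w
  have den_mul := wedgeProd_mul_wedgeProd (direction_right ▸ admissible_den hbc hxb hxc)
    (direction_left ▸ admissible_den hab hxa hxb)
    (cone_eq_union hn hq hp (by rw [h, add_comm])) w
  rw [Gam_eq_div hab, Gam_eq_div hbc, Gam_eq_div hac, direction_left, direction_right,
    div_mul_div_comm, num_mul, mul_comm (wedgeProd 1 b a _ x w), den_mul]

theorem dotProduct_cross_smul_eq {R : Type*} [CommRing R] {a b c : Fin 3 → R}
    (h : (a ⨯₃ b) ⬝ᵥ c = 0) : ((a ⨯₃ b) ⬝ᵥ (a ⨯₃ c)) • b =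
      ((a ⨯₃ b) ⬝ᵥ (b ⨯₃ c)) • a + ((a ⨯₃ b) ⬝ᵥ (a ⨯₃ b)) • c := by
  have expand : ((a ⨯₃ b) ⬝ᵥ c) • (a ⨯₃ b) = ((a ⨯₃ b) ⬝ᵥ (b ⨯₃ c)) • a +
      ((a ⨯₃ b) ⬝ᵥ (a ⨯₃ b)) • c - ((a ⨯₃ b) ⬝ᵥ (a ⨯₃ c)) • b := by
    funext i
    fin_cases i <;> simp [cross_apply, dotProduct, Fin.sum_univ_three] <;> ring
  rw [h, zero_smul] at expand
  exact (sub_eq_zero.1 expand.symm).symm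

theorem coeff_ne_zero_of_smul_eq_add {p q r : ℤ} (h : p • a = q • b + r • c) (hr : r ≠ 0)
    (hac : a ⨯₃ c ≠ 0) : q ≠ 0 := by
  rintro rfl
  have cross_relation : r • (a ⨯₃ c) = 0 := by
    simpa only [map_add, map_smul, cross_self, smul_zero, zero_smul, zero_add] using
      (congrArg (a ⨯₃ ·) h).symm
  exact smul_ne_zero hr hac cross_relation

theorem exists_pos_smul_eq_add_of_coplanar (ha : 0 < weight a x) (hb : 0 < weight b x)
    (hc : 0 < weight c x) (hab : a ⨯₃ b ≠ 0) (hbc : b ⨯₃ c ≠ 0) (hac : a ⨯₃ c ≠ 0)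
    (h : (a ⨯₃ b) ⬝ᵥ c = 0) :
    ∃ n p q : ℤ, 0 < n ∧ 0 < p ∧ 0 < q ∧
      (n • b = p • a + q • c ∨ n • c = p • b + q • a ∨ n • a = p • c + q • b) := by
  have relation := dotProduct_cross_smul_eq h
  have S_pos : 0 < (a ⨯₃ b) ⬝ᵥ (a ⨯₃ b) := lt_of_le_of_ne
    (Finset.sum_nonneg fun i _ => mul_self_nonneg _)
    fun h0 => hab (dotProduct_self_eq_zero.1 h0.symm)
  set S := (a ⨯₃ b) ⬝ᵥ (a ⨯₃ b)
  set T := (a ⨯₃ b) ⬝ᵥ (b ⨯₃ c)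
  set U := (a ⨯₃ b) ⬝ᵥ (a ⨯₃ c)
  have weight_relation : (U : ℝ) * weight b x = T * weight a x + S * weight c x := by
    simpa only [weight_add, weight_smul, eq_intCast] using congrArg (weight · x) relation
  have T_ne_zero : T ≠ 0 := coeff_ne_zero_of_smul_eq_add relation S_pos.ne' hbc
  have U_ne_zero : U ≠ 0 := by
    have relation' : -T • a = -U • b + S • c := by
      rw [neg_smul, neg_smul, relation]
      abel
    exact neg_ne_zero.1 (coeff_ne_zero_of_smul_eq_add relation' S_pos.ne' hac)
  rcases T_ne_zero.lt_or_gt with T_neg | T_pos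
  · rcases U_ne_zero.lt_or_gt with U_neg | U_pos
    · refine ⟨-T, S, -U, neg_pos.2 T_neg, S_pos, neg_pos.2 U_neg, Or.inr (Or.inr ?_)⟩
      rw [neg_smul, neg_smul, relation]
      abel
    · refine ⟨S, U, -T, S_pos, U_pos, neg_pos.2 T_neg, Or.inr (Or.inl ?_)⟩
      rw [neg_smul, relation]
      abel
  · have U_pos : 0 < U := by
      have : (0 : ℝ) < S := mod_cast S_pos
      have : (0 : ℝ) < T := mod_cast T_pos
      have : 0 < (U : ℝ) * weight b x := by rw [weight_relation]; positivity
      exact mod_cast (pos_iff_pos_of_mul_pos this).2 hb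
    exact ⟨U, T, S, U_pos, T_pos, S_pos, Or.inl relation⟩

theorem Gam_three_term_of_coplanar (hpa : IsPrimitive a) (hpb : IsPrimitive b)
    (hpc : IsPrimitive c) (ha : 0 < weight a x) (hb : 0 < weight b x) (hc : 0 < weight c x)
    (hdet : (a ⨯₃ b) ⬝ᵥ c = 0) {w : ℂ} (hab : w ∉ zerosPoles a b x) (hbc : w ∉ zerosPoles b c x)
    (hca : w ∉ zerosPoles c a x) : Gam a b w x * Gam b c w x * Gam c a w x = 1 := by
  rcases eq_or_cross_ne_zero hpa hpb ha hb with rfl | cross_ab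
  · rw [Gam_self, one_mul, Gam_mul_Gam_swap hpb hpc hb hc hbc]
  rcases eq_or_cross_ne_zero hpb hpc hb hc with rfl | cross_bc
  · rw [Gam_self, mul_one, Gam_mul_Gam_swap hpa hpc ha hc hab]
  rcases eq_or_cross_ne_zero hpc hpa hc ha with rfl | cross_ca
  · rw [Gam_self, mul_one, Gam_mul_Gam_swap hpa hpb ha hb hab]
  have cross_ac := cross_swap_ne_zero cross_ca
  obtain ⟨n, p, q, hn, hp, hq, b_between | c_between | a_between⟩ :=
    exists_pos_smul_eq_add_of_coplanar ha hb hc cross_ab cross_bc cross_ac hdet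
  · rw [Gam_mul_Gam_of_between hn hp hq b_between cross_ac ha hb hc, mul_comm,
      Gam_mul_Gam_swap hpc hpa hc ha hca]
  · rw [mul_assoc,
      Gam_mul_Gam_of_between hn hp hq c_between (cross_swap_ne_zero cross_ab) hb hc ha,
      Gam_mul_Gam_swap hpa hpb ha hb hab]
  · rw [mul_comm, ← mul_assoc,
      Gam_mul_Gam_of_between hn hp hq a_between (cross_swap_ne_zero cross_bc) hc ha hb, mul_comm,
      Gam_mul_Gam_swap hpb hpc hb hc hbc]

end CoplanarRelation

section DualFrame

open scoped Matrix

theorem formEval_algebraMap_comp (δ : Fin 3 → ℤ) (x : Fin 3 → ℂ) :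
    formEval (algebraMap ℤ ℝ ∘ δ) x = formEval δ x := by
  simp only [formEval, Function.comp_apply, ← IsScalarTower.algebraMap_apply ℤ ℝ ℂ]

/-- The vectors `u k` are positive multiples of the basis dual to the basis `v`. -/
structure IsDualFrame {ι R : Type*} [Fintype ι] [CommRing R] [LinearOrder R]
    (v u : ι → ι → R) : Prop where
  dotProduct_eq_zero : ∀ {k l}, k ≠ l → u k ⬝ᵥ v l = 0
  dotProduct_pos : ∀ k, 0 < u k ⬝ᵥ v k

/-- The integral points of the half-open parallelepiped spanned by the dual frame `u` of `v`. -/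
def dualBox {ι : Type*} [Fintype ι] (v u : ι → ι → ℤ) : Set (ι → ℤ) :=
  {δ | ∀ k, δ ⬝ᵥ v k ∈ Set.Ioc 0 (u k ⬝ᵥ v k)}

namespace IsDualFrame

variable {ι : Type*} [Fintype ι]

section OrderedRing

variable {R : Type*} [CommRing R] [LinearOrder R] {v u : ι → ι → R}

theorem sum_smul_dotProduct (h : IsDualFrame v u) (c : ι → R) (k : ι) :
    (∑ l, c l • u l) ⬝ᵥ v k = c k * (u k ⬝ᵥ v k) := by
  rw [sum_dotProduct, Finset.sum_eq_single k (fun l _ hl => by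
    rw [smul_dotProduct, h.dotProduct_eq_zero hl, smul_zero]) (by simp), smul_dotProduct,
    smul_eq_mul]

theorem eq_of_forall_dotProduct_eq [IsStrictOrderedRing R] (h : IsDualFrame v u) {δ δ' : ι → R}
    (hδ : ∀ k, δ ⬝ᵥ v k = δ' ⬝ᵥ v k) : δ = δ' := by
  classical
  have mul_transpose : Matrix.of u * (Matrix.of v)ᵀ = Matrix.diagonal fun k => u k ⬝ᵥ v k := by
    ext k l
    rcases eq_or_ne k l with rfl | hkl
    · rw [Matrix.diagonal_apply_eq]
      rfl
    · rw [Matrix.diagonal_apply_ne _ hkl]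
      exact h.dotProduct_eq_zero hkl
  have det_ne_zero : (Matrix.of v).det ≠ 0 := by
    have := congrArg Matrix.det mul_transpose
    rw [Matrix.det_mul, Matrix.det_transpose, Matrix.det_diagonal] at this
    exact right_ne_zero_of_mul
      (this ▸ Finset.prod_ne_zero_iff.2 fun k _ => (h.dotProduct_pos k).ne')
  refine sub_eq_zero.1 (Matrix.eq_zero_of_mulVec_eq_zero det_ne_zero (funext fun k => ?_))
  exact (dotProduct_comm _ _).trans (by rw [sub_dotProduct]; exact sub_eq_zero.2 (hδ k))

theorem map {S : Type*} [CommRing S] [LinearOrder S] (h : IsDualFrame v u) (f : R →+* S)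
    (hf : StrictMono f) : IsDualFrame (fun k => f ∘ v k) (fun k => f ∘ u k) where
  dotProduct_eq_zero hkl := by
    rw [← RingHom.map_dotProduct, h.dotProduct_eq_zero hkl, map_zero]
  dotProduct_pos k := by
    rw [← RingHom.map_dotProduct, ← map_zero f]
    exact hf (h.dotProduct_pos k)

end OrderedRing

theorem eq_sum_smul {K : Type*} [Field K] [LinearOrder K] [IsStrictOrderedRing K]
    {v u : ι → ι → K} (h : IsDualFrame v u) (δ : ι → K) :
    δ = ∑ k, (δ ⬝ᵥ v k / (u k ⬝ᵥ v k)) • u k :=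
  h.eq_of_forall_dotProduct_eq fun k => by
    rw [h.sum_smul_dotProduct, div_mul_cancel₀ _ (h.dotProduct_pos k).ne']

variable {v u : ι → ι → ℤ}

theorem finite_dualBox (h : IsDualFrame v u) : (dualBox v u).Finite := by
  have injOn : Set.InjOn (fun δ k => δ ⬝ᵥ v k) (dualBox v u) := fun δ _ δ' _ hδ =>
    h.eq_of_forall_dotProduct_eq (congrFun hδ)
  exact Set.Finite.of_injOn (t := {d | ∀ k, d k ∈ Set.Ioc 0 (u k ⬝ᵥ v k)}) (fun δ hδ => hδ) injOn
    (Set.Finite.pi' fun k => Set.finite_Ioc _ _)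

theorem eq_of_modEq (h : IsDualFrame v u) {δ δ' : ι → ℤ} (hδ : δ ∈ dualBox v u)
    (hδ' : δ' ∈ dualBox v u) (hmod : ∀ k, δ ⬝ᵥ v k ≡ δ' ⬝ᵥ v k [ZMOD u k ⬝ᵥ v k]) : δ = δ' := by
  refine h.eq_of_forall_dotProduct_eq fun k => sub_eq_zero.1 ?_
  refine Int.eq_zero_of_abs_lt_dvd (hmod k).symm.dvd (abs_lt.2 ⟨?_, ?_⟩) <;>
    linarith [(hδ k).1, (hδ k).2, (hδ' k).1, (hδ' k).2]

theorem exists_sub_sum_smul_mem_dualBox (h : IsDualFrame v u) (δ : ι → ℤ) :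
    ∃ c : ι → ℤ, δ - ∑ k, c k • u k ∈ dualBox v u := by
  refine ⟨fun k => toIocDiv (h.dotProduct_pos k) 0 (δ ⬝ᵥ v k), fun k => ?_⟩
  rw [sub_dotProduct, h.sum_smul_dotProduct, ← smul_eq_mul]
  simpa only [zero_add] using sub_toIocDiv_zsmul_mem_Ioc (h.dotProduct_pos k) 0 (δ ⬝ᵥ v k)

variable (x : Fin 3 → ℂ)

theorem formEval_eq_sum {v u : Fin 3 → Fin 3 → ℝ} (h : IsDualFrame v u) (δ : Fin 3 → ℝ) :
    formEval δ x = ∑ k, ((δ ⬝ᵥ v k / (u k ⬝ᵥ v k) : ℝ) : ℂ) * formEval (u k) x := by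
  conv_lhs => rw [h.eq_sum_smul δ]
  simp only [formEval, Finset.sum_apply, map_sum, Pi.smul_apply, smul_eq_mul, map_mul,
    Finset.sum_mul, Finset.mul_sum, Complex.coe_algebraMap, mul_assoc]
  exact Finset.sum_comm

variable {v u : Fin 3 → Fin 3 → ℤ}

theorem formEval_eq_sum_intCast (h : IsDualFrame v u) (δ : Fin 3 → ℤ) :
    formEval δ x = ∑ k, (((δ ⬝ᵥ v k : ℤ) / (u k ⬝ᵥ v k : ℤ) : ℝ) : ℂ) * formEval (u k) x := by
  have := (h.map (algebraMap ℤ ℝ) Int.cast_strictMono).formEval_eq_sum x (algebraMap ℤ ℝ ∘ δ)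
  simpa only [← RingHom.map_dotProduct, formEval_algebraMap_comp, eq_intCast] using this

theorem sum_weight_div_mul_formEval (h : IsDualFrame v u) :
    ∑ k, ((weight (v k) x / (u k ⬝ᵥ v k : ℤ) : ℝ) : ℂ) * formEval (u k) x = 0 := by
  set y : Fin 3 → ℝ := (fun i => (x i).im) ⨯₃ (fun i => (x i).re) with hy
  have formEval_y : formEval y x = 0 := by
    apply Complex.ext <;> simp [formEval, hy, cross_apply, Fin.sum_univ_three] <;> ring
  have := (h.map (algebraMap ℤ ℝ) Int.cast_strictMono).formEval_eq_sum x y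
  have weight_eq (k) : y ⬝ᵥ (algebraMap ℤ ℝ ∘ v k) = weight (v k) x := dotProduct_comm _ _
  simpa only [formEval_y, weight_eq, ← RingHom.map_dotProduct, formEval_algebraMap_comp,
    eq_intCast] using this.symm

end IsDualFrame

end DualFrame

section BoxTranslate

open Complex
open scoped Matrix

/-- The translates of `δ` by `m • u i - (n + 1) • u j` with `m` and `n` natural numbers. For `δ` in
the box of a dual frame `u` of `v`, they represent the points of `cone (v i) (v j)` modulo the
remaining vector of `u`. -/
def boxTranslate {ι : Type*} (u : ι → ι → ℤ) (i j : ι) (δ : ι → ℤ) (p : ℕ × ℕ) : ι → ℤ :=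
  δ + (p.1 : ℤ) • u i - ((p.2 : ℤ) + 1) • u j

namespace IsDualFrame

section Fintype

variable {ι : Type*} [Fintype ι] {v u : ι → ι → ℤ} {i j : ι}

theorem boxTranslate_dotProduct_left (h : IsDualFrame v u) (hij : i ≠ j) (δ : ι → ℤ) (p : ℕ × ℕ) :
    boxTranslate u i j δ p ⬝ᵥ v i = δ ⬝ᵥ v i + p.1 * (u i ⬝ᵥ v i) := by
  simp only [boxTranslate, sub_dotProduct, add_dotProduct, smul_dotProduct, smul_eq_mul,
    h.dotProduct_eq_zero hij.symm, mul_zero, sub_zero]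

theorem boxTranslate_dotProduct_right (h : IsDualFrame v u) (hij : i ≠ j) (δ : ι → ℤ)
    (p : ℕ × ℕ) :
    boxTranslate u i j δ p ⬝ᵥ v j = δ ⬝ᵥ v j - (p.2 + 1) * (u j ⬝ᵥ v j) := by
  simp only [boxTranslate, sub_dotProduct, add_dotProduct, smul_dotProduct, smul_eq_mul,
    h.dotProduct_eq_zero hij, mul_zero, add_zero]

theorem dotProduct_modEq_zero (h : IsDualFrame v u) (k l : ι) :
    u k ⬝ᵥ v l ≡ 0 [ZMOD u l ⬝ᵥ v l] := by
  rcases eq_or_ne k l with rfl | hkl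
  · exact Int.modEq_zero_iff_dvd.2 dvd_rfl
  · rw [h.dotProduct_eq_zero hkl]

theorem boxTranslate_modEq (h : IsDualFrame v u) (i j : ι) (δ : ι → ℤ) (p : ℕ × ℕ) (l : ι) :
    boxTranslate u i j δ p ⬝ᵥ v l ≡ δ ⬝ᵥ v l [ZMOD u l ⬝ᵥ v l] := by
  simp only [boxTranslate, sub_dotProduct, add_dotProduct, smul_dotProduct, smul_eq_mul]
  simpa only [mul_zero, add_zero, sub_zero] using
    (((Int.ModEq.refl (δ ⬝ᵥ v l)).add ((h.dotProduct_modEq_zero i l).mul_left _)).sub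
      ((h.dotProduct_modEq_zero j l).mul_left ((p.2 : ℤ) + 1)))

end Fintype

variable {v u : Fin 3 → Fin 3 → ℤ} {i j k : Fin 3} {ε : ℤ} {x : Fin 3 → ℂ}

theorem boxTranslate_mem_cone (h : IsDualFrame v u) (hij : i ≠ j) {δ : Fin 3 → ℤ}
    (hδ : δ ∈ dualBox v u) (p : ℕ × ℕ) : boxTranslate u i j δ p ∈ cone (v i) (v j) := by
  have := h.dotProduct_pos i
  have := h.dotProduct_pos j
  refine ⟨?_, ?_⟩
  · rw [h.boxTranslate_dotProduct_left hij]
    have := (hδ i).1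
    positivity
  · rw [h.boxTranslate_dotProduct_right hij]
    have : 0 ≤ (p.2 : ℤ) * (u j ⬝ᵥ v j) := by positivity
    linarith [(hδ j).2]

/-- The orbit in `cone (v i) (v j)` modulo `u k` of a translate of a point of the box. -/
def boxOrbit (h : IsDualFrame v u) (hij : i ≠ j) (k : Fin 3) (p : dualBox v u × ℕ × ℕ) :
    orbits (cone (v i) (v j)) (u k) :=
  ⟨_, boxTranslate u i j p.1 p.2, h.boxTranslate_mem_cone hij p.1.2 p.2, rfl⟩

theorem boxOrbit_injective (h : IsDualFrame v u) (hij : i ≠ j) (hik : i ≠ k) (hjk : j ≠ k) :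
    Function.Injective (h.boxOrbit hij k) := by
  rintro ⟨δ, p⟩ ⟨δ', p'⟩ orbit_eq
  obtain ⟨n, hn⟩ := AddSubgroup.mem_zmultiples_iff.1
    (QuotientAddGroup.eq.1 (congrArg Subtype.val orbit_eq))
  have dot_eq (l) : boxTranslate u i j δ' p' ⬝ᵥ v l =
      boxTranslate u i j δ p ⬝ᵥ v l + n * (u k ⬝ᵥ v l) := by
    rw [← smul_eq_mul, ← smul_dotProduct, hn, ← add_dotProduct, add_neg_cancel_left]
  obtain rfl : δ = δ' := Subtype.ext <| h.eq_of_modEq δ.2 δ'.2 fun l => calc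
    δ.1 ⬝ᵥ v l ≡ boxTranslate u i j δ p ⬝ᵥ v l + n * 0 [ZMOD u l ⬝ᵥ v l] := by
      simpa only [mul_zero, add_zero] using (h.boxTranslate_modEq i j δ p l).symm
    _ ≡ boxTranslate u i j δ' p' ⬝ᵥ v l [ZMOD u l ⬝ᵥ v l] := by
      rw [dot_eq]
      exact (((h.dotProduct_modEq_zero k l).mul_left n).add_left _).symm
    _ ≡ δ'.1 ⬝ᵥ v l [ZMOD u l ⬝ᵥ v l] := h.boxTranslate_modEq i j δ' p' l
  have left := dot_eq i
  have right := dot_eq j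
  rw [h.dotProduct_eq_zero hik.symm, h.boxTranslate_dotProduct_left hij,
    h.boxTranslate_dotProduct_left hij, mul_zero, add_zero, add_right_inj] at left
  rw [h.dotProduct_eq_zero hjk.symm, h.boxTranslate_dotProduct_right hij,
    h.boxTranslate_dotProduct_right hij, mul_zero, add_zero, sub_right_inj] at right
  have fst_eq := mul_right_cancel₀ (h.dotProduct_pos i).ne' left
  have snd_eq := mul_right_cancel₀ (h.dotProduct_pos j).ne' right
  exact Prod.ext rfl (Prod.ext (by lia) (by lia))

theorem boxOrbit_surjective (h : IsDualFrame v u) (hij : i ≠ j)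
    (hadm : Admissible ε (v i) (v j) (u k) x) :
    Function.Surjective (h.boxOrbit hij k) := by
  rintro ⟨_, δ, hδ, rfl⟩
  obtain ⟨c, hc⟩ := h.exists_sub_sum_smul_mem_dualBox δ
  have dot_eq (l) : δ ⬝ᵥ v l = (δ - ∑ k, c k • u k) ⬝ᵥ v l + c l * (u l ⬝ᵥ v l) := by
    rw [sub_dotProduct, h.sum_smul_dotProduct, sub_add_cancel]
  set δ₀ := δ - ∑ k, c k • u k
  have left_nonneg : 0 ≤ c i := not_lt.1 fun hlt => by
    nlinarith [hδ.1, dot_eq i, (hc i).2, h.dotProduct_pos i]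
  have right_neg : 0 ≤ -c j - 1 := not_lt.1 fun hlt => by
    nlinarith [hδ.2, dot_eq j, (hc j).1, h.dotProduct_pos j]
  obtain ⟨m, hm⟩ := Int.eq_ofNat_of_zero_le left_nonneg
  obtain ⟨n, hn⟩ := Int.eq_ofNat_of_zero_le right_neg
  refine ⟨(⟨δ₀, hc⟩, m, n), Subtype.ext (hadm.mk_eq_mk ?_ ?_)⟩
  · rw [h.boxTranslate_dotProduct_left hij, dot_eq i, hm]
  · rw [h.boxTranslate_dotProduct_right hij, dot_eq j, ← hn]
    ring

theorem wedgeProd_eq_prod [Fintype (dualBox v u)] (h : IsDualFrame v u) (hij : i ≠ j) (hik : i ≠ k)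
    (hjk : j ≠ k) (hadm : Admissible ε (v i) (v j) (u k) x) {w : ℂ} {P : dualBox v u → ℂ}
    (hP : ∀ δ, HasProd (fun p : ℕ × ℕ => 1 - expPeriod (formEval (u k) x) (ε *
      (formEval δ.1 x + p.1 * formEval (u i) x - (p.2 + 1) * formEval (u j) x - w))) (P δ)) :
    wedgeProd ε (v i) (v j) (u k) x w = ∏ δ, P δ := by
  have hasProd : HasProd (fun p => factor ε (u k) w x (h.boxOrbit hij k p))
      (wedgeProd ε (v i) (v j) (u k) x w) :=
    (Equiv.ofBijective _
      ⟨h.boxOrbit_injective hij hik hjk, h.boxOrbit_surjective hij hadm⟩).hasProd_iff.2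
      (hadm.multipliable w).hasProd
  refine (hasProd.prod_fiberwise fun δ => (hP δ).congr_fun fun p => ?_).unique (hasProd_fintype P)
  simp only [boxOrbit, boxTranslate, factor_mk, formEval_sub, formEval_add, formEval_zsmul]
  push_cast
  rfl

end IsDualFrame

end BoxTranslate

section CyclicFrame

open Filter Topology Complex
open scoped Matrix

theorem im_formEval_div_pos {a b δ : Fin 3 → ℤ} {x : Fin 3 → ℂ} (h : a ⨯₃ b ≠ 0)
    (ha : 0 < weight a x) (hb : 0 < weight b x) (hδa : δ ⬝ᵥ a ≤ 0) (hδb : 0 ≤ δ ⬝ᵥ b)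
    (hδ : δ ⬝ᵥ a < δ ⬝ᵥ b) : 0 < (formEval δ x / formEval (directionVector a b) x).im := by
  obtain ⟨c, hc, im_eq⟩ := exists_im_formEval_div h hb
  rw [im_eq]
  rcases hδb.eq_or_lt with h0 | hpos
  · have : ((δ ⬝ᵥ a : ℤ) : ℝ) < 0 := Int.cast_lt_zero.2 (h0 ▸ hδ)
    rw [← h0, Int.cast_zero, mul_zero, zero_sub, neg_pos]
    exact mul_neg_of_pos_of_neg (by positivity) this
  · have : (0 : ℝ) < (δ ⬝ᵥ b : ℤ) := Int.cast_pos.2 hpos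
    have : c * weight b x * (δ ⬝ᵥ a : ℤ) ≤ 0 :=
      mul_nonpos_of_nonneg_of_nonpos (by positivity) (Int.cast_nonpos.2 hδa)
    have : 0 < c * weight a x * (δ ⬝ᵥ b : ℤ) := by positivity
    linarith

/-- The direction vectors of the three wedges `(v (k + 1), v (k + 2))`, with cyclic indices. -/
def dualFrame (v : Fin 3 → Fin 3 → ℤ) (k : Fin 3) : Fin 3 → ℤ :=
  directionVector (v (k + 1)) (v (k + 2))

/-- The values at `x` of the forms `dualFrame v k`: the periods of the Barnes kernel for `v`. -/
def frameValue (v : Fin 3 → Fin 3 → ℤ) (x : Fin 3 → ℂ) (k : Fin 3) : ℂ :=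
  formEval (dualFrame v k) x

variable {v : Fin 3 → Fin 3 → ℤ} {x : Fin 3 → ℂ}

theorem cross_dotProduct_eq_det (v : Fin 3 → Fin 3 → ℤ) (k : Fin 3) :
    (v (k + 1) ⨯₃ v (k + 2)) ⬝ᵥ v k = (Matrix.of v).det := by
  rw [Matrix.det_fin_three]
  fin_cases k <;>
    simp only [cross_apply, dotProduct, Fin.sum_univ_three, Matrix.cons_val, Matrix.of_apply,
      Fin.zero_eta, Fin.mk_one, Fin.reduceFinMk, Fin.reduceAdd, zero_add] <;>
    ring

theorem cross_ne_zero_of_det_ne_zero (hv : (Matrix.of v).det ≠ 0) (k : Fin 3) :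
    v (k + 1) ⨯₃ v (k + 2) ≠ 0 := by
  intro h
  rw [← cross_dotProduct_eq_det v k, h, zero_dotProduct] at hv
  exact hv rfl

theorem eq_add_one_or_eq_add_two {k l : Fin 3} (h : k ≠ l) : l = k + 1 ∨ l = k + 2 := by
  decide +revert

theorem isDualFrame_dualFrame (hv : 0 < (Matrix.of v).det) : IsDualFrame v (dualFrame v) where
  dotProduct_eq_zero {k l} hkl := by
    rcases eq_add_one_or_eq_add_two hkl with rfl | rfl
    · exact directionVector_dot_left (cross_ne_zero_of_det_ne_zero hv.ne' k)
    · exact directionVector_dot_right (cross_ne_zero_of_det_ne_zero hv.ne' k)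
  dotProduct_pos k := by
    obtain ⟨s, hs, cross_eq⟩ := exists_cross_eq_smul (cross_ne_zero_of_det_ne_zero hv.ne' k)
    rw [← cross_dotProduct_eq_det v k, cross_eq, smul_dotProduct, smul_eq_mul] at hv
    exact (mul_pos_iff_of_pos_left hs).1 hv

theorem pairIndep_frameValue (hv : 0 < (Matrix.of v).det) (hw : ∀ k, 0 < weight (v k) x) :
    PairIndep (frameValue v x) := by
  intro l k hlk
  have h := isDualFrame_dualFrame hv
  obtain ⟨s, -, cross_eq⟩ := exists_cross_eq_smul (cross_ne_zero_of_det_ne_zero hv.ne' k)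
  refine right_ne_zero_of_mul
    (ne_of_eq_of_ne (im_formEval_mul_conj_directionVector cross_eq (dualFrame v l) x) ?_)
  have dot_ne_zero : ((dualFrame v l ⬝ᵥ v l : ℤ) : ℝ) ≠ 0 :=
    Int.cast_ne_zero.2 (h.dotProduct_pos l).ne'
  rcases eq_add_one_or_eq_add_two hlk.symm with rfl | rfl
  · rw [h.dotProduct_eq_zero (by simp : k + 1 ≠ k + 2), Int.cast_zero, zero_mul, zero_sub]
    exact neg_ne_zero.2 (mul_ne_zero dot_ne_zero (hw _).ne')
  · rw [h.dotProduct_eq_zero (by simp : k + 2 ≠ k + 1), Int.cast_zero, zero_mul, sub_zero]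
    exact mul_ne_zero dot_ne_zero (hw _).ne'

theorem im_frameValue_div_neg (hv : 0 < (Matrix.of v).det) (hw : ∀ k, 0 < weight (v k) x)
    (k : Fin 3) : (frameValue v x (k + 1) / frameValue v x k).im < 0 := by
  have h := isDualFrame_dualFrame hv
  have left := h.dotProduct_pos (k + 1)
  have right := h.dotProduct_eq_zero (by simp : k + 1 ≠ k + 2)
  rw [← neg_pos, ← neg_im, ← neg_div, frameValue, ← formEval_neg]
  apply im_formEval_div_pos (cross_ne_zero_of_det_ne_zero hv.ne' k) (hw _) (hw _) <;>
    simp only [neg_dotProduct] <;> lia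

theorem im_frameValue_div_pos (hv : 0 < (Matrix.of v).det) (hw : ∀ k, 0 < weight (v k) x)
    (k : Fin 3) : 0 < (frameValue v x (k + 2) / frameValue v x k).im := by
  have h := isDualFrame_dualFrame hv
  have left := h.dotProduct_eq_zero (by simp : k + 2 ≠ k + 1)
  have right := h.dotProduct_pos (k + 2)
  apply im_formEval_div_pos (cross_ne_zero_of_det_ne_zero hv.ne' k) (hw _) (hw _) <;> lia

theorem eventually_im_sub_div_pos (hv : 0 < (Matrix.of v).det) (hw : ∀ k, 0 < weight (v k) x)
    {δ : Fin 3 → ℤ} (hδ : δ ∈ dualBox v (dualFrame v)) (k : Fin 3) : ∀ᶠ w in 𝓝 (0 : ℂ),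
      0 < ((w - formEval δ x + frameValue v x (k + 2)) / frameValue v x k).im ∧
      0 < ((-(w - formEval δ x) - frameValue v x (k + 1)) / frameValue v x k).im := by
  have h := isDualFrame_dualFrame hv
  have dot_left := h.dotProduct_eq_zero (by simp : k + 2 ≠ k + 1)
  have dot_right := h.dotProduct_eq_zero (by simp : k + 1 ≠ k + 2)
  obtain ⟨left_pos, left_le⟩ := hδ (k + 1)
  obtain ⟨right_pos, right_le⟩ := hδ (k + 2)
  have eventually_pos {f : ℂ → ℂ} (hf : Continuous f) {α : Fin 3 → ℤ} (hα : f 0 = formEval α x)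
      (ha : α ⬝ᵥ v (k + 1) ≤ 0) (hb : 0 ≤ α ⬝ᵥ v (k + 2)) (hab : α ⬝ᵥ v (k + 1) < α ⬝ᵥ v (k + 2)) :
      ∀ᶠ w in 𝓝 (0 : ℂ), 0 < (f w / frameValue v x k).im := by
    refine (continuous_im.comp (hf.div_const _)).continuousAt.eventually (lt_mem_nhds ?_)
    simp only [Function.comp_apply, hα]
    exact im_formEval_div_pos (cross_ne_zero_of_det_ne_zero hv.ne' k) (hw _) (hw _) ha hb hab
  refine (eventually_pos (f := fun w => w - formEval δ x + frameValue v x (k + 2))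
    (α := dualFrame v (k + 2) - δ) (by fun_prop) ?_ ?_ ?_ ?_).and
    (eventually_pos (f := fun w => -(w - formEval δ x) - frameValue v x (k + 1))
    (α := δ - dualFrame v (k + 1)) (by fun_prop) ?_ ?_ ?_ ?_)
  · rw [formEval_sub, frameValue]
    ring
  rotate_left 3
  · rw [formEval_sub, frameValue]
    ring
  all_goals
    simp only [sub_dotProduct]
    lia

theorem eventually_Gam_eq_exp [Fintype (dualBox v (dualFrame v))] (hv : 0 < (Matrix.of v).det)
    (hw : ∀ k, 0 < weight (v k) x) (k : Fin 3) : ∀ᶠ w in 𝓝 (0 : ℂ),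
      (∀ δ : dualBox v (dualFrame v),
        Summable (poleResidue (frameValue v x) (w - formEval δ.1 x) k)) ∧
      Gam (v (k + 1)) (v (k + 2)) w x = exp (2 * Real.pi * I *
        ∑ δ : dualBox v (dualFrame v),
          ∑' n, poleResidue (frameValue v x) (w - formEval δ.1 x) k n) := by
  have h := isDualFrame_dualFrame hv
  have cross_ne_zero := cross_ne_zero_of_det_ne_zero hv.ne' k
  have erase_eq : ∀ k : Fin 3, Finset.univ.erase k = {k + 1, k + 2} := by decide
  filter_upwards [eventually_all.2 fun δ : dualBox v (dualFrame v) =>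
    eventually_im_sub_div_pos hv hw δ.2 k] with w im_pos
  choose S T prod_S prod_T sum_ST using fun δ => exists_hasProd_hasSum_poleResidue
    (by simp : k + 1 ≠ k + 2) (erase_eq k) (im_frameValue_div_neg hv hw k)
    (im_frameValue_div_pos hv hw k) (im_pos δ).1 (im_pos δ).2
  have num_eq : wedgeProd (-1) (v (k + 1)) (v (k + 2)) (dualFrame v k) x w = ∏ δ, exp (-S δ) := by
    refine h.wedgeProd_eq_prod (by simp) (by simp) (by simp)
      (admissible_num cross_ne_zero (hw _) (hw _)) fun δ => (prod_S δ).congr_fun fun p => ?_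
    congr 2
    simp only [frameValue]
    push_cast
    ring
  have den_eq : wedgeProd 1 (v (k + 2)) (v (k + 1)) (dualFrame v k) x w = ∏ δ, exp (-T δ) := by
    refine h.wedgeProd_eq_prod (by simp) (by simp) (by simp)
      (admissible_den cross_ne_zero (hw _) (hw _)) fun δ => (prod_T δ).congr_fun fun p => ?_
    congr 2
    simp only [frameValue]
    push_cast
    ring
  refine ⟨fun δ => (summable_mul_left_iff two_pi_I_ne_zero).1 (sum_ST δ).summable, ?_⟩
  rw [Gam_eq_div cross_ne_zero, ← dualFrame, num_eq, den_eq, ← exp_sum, ← exp_sum, ← exp_sub,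
    ← Finset.sum_sub_distrib, Finset.mul_sum]
  refine congrArg exp (Finset.sum_congr rfl fun δ _ => ?_)
  rw [← tsum_mul_left, (sum_ST δ).tsum_eq]
  ring

end CyclicFrame

section ThreeTermRelation

open Filter Topology Complex
open scoped Matrix

section OpenCube

variable {ι : Type*} [Fintype ι] [Nontrivial ι] {o : ι → ℂ}

theorem PairIndep.linearCombination_surjective (h : PairIndep o) :
    Function.Surjective (Fintype.linearCombination ℝ o) := by
  classical
  obtain ⟨k, l, hkl⟩ := exists_pair_ne ι
  have im_ne_zero := ofReal_ne_zero.2 (h hkl)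
  intro z
  have cramer : ((z * (starRingEnd ℂ) (o l)).im : ℂ) * o k -
      (z * (starRingEnd ℂ) (o k)).im * o l = (o k * (starRingEnd ℂ) (o l)).im * z := by
    apply Complex.ext <;>
      simp only [sub_re, sub_im, mul_re, mul_im, ofReal_re, ofReal_im, conj_re, conj_im] <;> ring
  refine ⟨Pi.single k ((z * (starRingEnd ℂ) (o l)).im / (o k * (starRingEnd ℂ) (o l)).im) -
    Pi.single l ((z * (starRingEnd ℂ) (o k)).im / (o k * (starRingEnd ℂ) (o l)).im), ?_⟩
  rw [map_sub, Fintype.linearCombination_apply_single, Fintype.linearCombination_apply_single,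
    real_smul, real_smul, ofReal_div, ofReal_div, div_mul_eq_mul_div, div_mul_eq_mul_div, ← sub_div,
    cramer, mul_div_cancel_left₀ _ im_ne_zero]

theorem PairIndep.eventually_exists_mem_Ioo (h : PairIndep o) {s t : ι → ℝ}
    (hs : ∀ k, s k ∈ Set.Ioc 0 1) (ht : ∀ k, 0 < t k) (hsum : ∑ k, (t k : ℂ) * o k = 0) :
    ∀ᶠ z in 𝓝 (∑ k, (s k : ℂ) * o k),
      ∃ r : ι → ℝ, (∀ k, r k ∈ Set.Ioo 0 1) ∧ z = ∑ k, (r k : ℂ) * o k := by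
  have eventually_mem : ∀ᶠ η in 𝓝[>] (0 : ℝ), ∀ k, s k - η * t k ∈ Set.Ioo 0 1 := by
    refine eventually_all.2 fun k => ?_
    have tendsto : Tendsto (fun η : ℝ => s k - η * t k) (𝓝[>] 0) (𝓝 (s k)) :=
      (Continuous.tendsto' (by fun_prop) _ _ (by simp)).mono_left nhdsWithin_le_nhds
    filter_upwards [tendsto.eventually (lt_mem_nhds (hs k).1), self_mem_nhdsWithin] with η pos hη
    exact ⟨pos, (sub_lt_self _ (mul_pos hη (ht k))).trans_le (hs k).2⟩
  obtain ⟨η, hη⟩ := eventually_mem.exists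
  have isOpenMap := (Fintype.linearCombination ℝ o).isOpenMap_of_finiteDimensional
    h.linearCombination_surjective
  have eq_apply : ∑ k, (s k : ℂ) * o k = Fintype.linearCombination ℝ o fun k => s k - η * t k := by
    simp only [Fintype.linearCombination_apply, real_smul, ofReal_sub, ofReal_mul, sub_mul,
      mul_assoc, Finset.sum_sub_distrib, ← Finset.mul_sum, hsum, mul_zero, sub_zero]
  rw [eq_apply]
  filter_upwards [isOpenMap.image_mem_nhds (set_pi_mem_nhds Set.finite_univ fun k _ =>
    isOpen_Ioo.mem_nhds (hη k))]
  rintro _ ⟨r, hr, rfl⟩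
  exact ⟨r, fun k => hr k (Set.mem_univ k), by
    simp only [Fintype.linearCombination_apply, real_smul]⟩

end OpenCube

variable {v : Fin 3 → Fin 3 → ℤ} {x : Fin 3 → ℂ}

theorem eventually_exists_sub_formEval_eq (hv : 0 < (Matrix.of v).det)
    (hw : ∀ k, 0 < weight (v k) x) {δ : Fin 3 → ℤ} (hδ : δ ∈ dualBox v (dualFrame v)) :
    ∀ᶠ w in 𝓝 (0 : ℂ), ∃ s : Fin 3 → ℝ, (∀ k, s k ∈ Set.Ioo 0 1) ∧
      w - formEval δ x = -∑ k, s k * frameValue v x k := by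
  have h := isDualFrame_dualFrame hv
  have dot_pos (k) : (0 : ℝ) < (dualFrame v k ⬝ᵥ v k : ℤ) := Int.cast_pos.2 (h.dotProduct_pos k)
  have coeff_mem (k) : ((δ ⬝ᵥ v k : ℤ) / (dualFrame v k ⬝ᵥ v k : ℤ) : ℝ) ∈ Set.Ioc 0 1 :=
    ⟨div_pos (Int.cast_pos.2 (hδ k).1) (dot_pos k),
      (div_le_one (dot_pos k)).2 (Int.cast_le.2 (hδ k).2)⟩
  have eventually_eq := (pairIndep_frameValue hv hw).eventually_exists_mem_Ioo coeff_mem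
    (fun k => div_pos (hw k) (dot_pos k)) (h.sum_weight_div_mul_formEval x)
  have tendsto : Tendsto (fun w => formEval δ x - w) (𝓝 0) (𝓝 (formEval δ x)) :=
    Continuous.tendsto' (by fun_prop) _ _ (sub_zero _)
  refine (tendsto.eventually (h.formEval_eq_sum_intCast x δ ▸ eventually_eq)).mono ?_
  rintro w ⟨s, hs, sub_eq⟩
  exact ⟨s, hs, by rw [← sub_eq, neg_sub]⟩

theorem eventually_prod_Gam_eq_exp [Fintype (dualBox v (dualFrame v))]
    (hv : 0 < (Matrix.of v).det) (hw : ∀ k, 0 < weight (v k) x) : ∀ᶠ w in 𝓝 (0 : ℂ),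
      ∏ k, Gam (v (k + 1)) (v (k + 2)) w x = exp (-(2 * Real.pi * I) *
        ∑ δ : dualBox v (dualFrame v), originResidue (frameValue v x) (w - formEval δ.1 x)) := by
  filter_upwards [eventually_all.2 (eventually_Gam_eq_exp hv hw),
    eventually_all.2 fun δ : dualBox v (dualFrame v) =>
      eventually_exists_sub_formEval_eq hv hw δ.2] with w Gam_eq exists_coeff
  simp only [fun k => (Gam_eq k).2]
  rw [← exp_sum, ← Finset.mul_sum, Finset.sum_comm, neg_mul, ← mul_neg, ← Finset.sum_neg_distrib]
  refine congrArg (fun z => exp (2 * Real.pi * I * z)) (Finset.sum_congr rfl fun δ _ => ?_)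
  obtain ⟨s, hs, sub_eq⟩ := exists_coeff δ
  exact sum_tsum_poleResidue (pairIndep_frameValue hv hw) hs sub_eq fun k => (Gam_eq k).1 δ

theorem div_eq_of_eventually_div_eq {f g h : ℂ → ℂ} (hf : Differentiable ℂ f)
    (hg : Differentiable ℂ g) (hh : Differentiable ℂ h) (hh0 : ∀ w, h w ≠ 0) {w₀ : ℂ}
    (heq : ∀ᶠ w in 𝓝 w₀, f w / g w = h w) {w : ℂ} (hw : g w ≠ 0) : f w / g w = h w := by
  have eventually_eq : f =ᶠ[𝓝 w₀] h * g := by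
    filter_upwards [heq] with u hu
    have hgu : g u ≠ 0 := fun h0 => hh0 u (by rw [← hu, h0, div_zero])
    exact (div_eq_iff hgu).1 hu
  have eq_mul := AnalyticOnNhd.eq_of_eventuallyEq (fun u _ => hf.analyticAt u)
    (fun u _ => (hh.mul hg).analyticAt u) eventually_eq
  exact (div_eq_iff hw).2 (congrFun eq_mul w)

theorem prod_Gam_eq_exp [Fintype (dualBox v (dualFrame v))] (hv : 0 < (Matrix.of v).det)
    (hw : ∀ k, 0 < weight (v k) x) {w : ℂ}
    (hzeros : ∀ k, w ∉ zerosPoles (v (k + 1)) (v (k + 2)) x) :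
    ∏ k, Gam (v (k + 1)) (v (k + 2)) w x = exp (-(2 * Real.pi * I) *
      ∑ δ : dualBox v (dualFrame v), originResidue (frameValue v x) (w - formEval δ.1 x)) := by
  have cross_ne_zero := cross_ne_zero_of_det_ne_zero hv.ne'
  have near_zero := eventually_prod_Gam_eq_exp hv hw
  have residue_eq (z) := originResidue_fin_three (pairIndep_frameValue hv hw).ne_zero z
  simp only [fun k => Gam_eq_div (cross_ne_zero k), Finset.prod_div_distrib, residue_eq]
    at near_zero ⊢
  refine div_eq_of_eventually_div_eq
    (Differentiable.fun_finsetProd (u := Finset.univ) fun k _ =>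
      (admissible_num (cross_ne_zero k) (hw _) (hw _)).differentiable)
    (Differentiable.fun_finsetProd (u := Finset.univ) fun k _ =>
      (admissible_den (cross_ne_zero k) (hw _) (hw _)).differentiable) ?_
    (fun _ => exp_ne_zero _) near_zero (Finset.prod_ne_zero_iff.2 fun k _ =>
      (wedgeProd_ne_zero_of_notMem (cross_ne_zero k) (hw _) (hw _) (hzeros k)).2)
  unfold bernoulliThree
  fun_prop

end ThreeTermRelation

section RatFun

open MvPolynomial

variable {x : Fin 3 → ℂ} {n d : MvPolynomial (Fin 3) ℚ}

theorem RatFun.num_mul_eq_mul_den {f : RatFun} (hd : d ≠ 0)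
    (hf : f = algebraMap _ RatFun n / algebraMap _ RatFun d) :
    IsFractionRing.num (MvPolynomial (Fin 3) ℚ) f * d =
      n * IsFractionRing.den (MvPolynomial (Fin 3) ℚ) f := by
  have injective := IsFractionRing.injective (MvPolynomial (Fin 3) ℚ) RatFun
  have num_div_den := IsFractionRing.mk'_num_den' (MvPolynomial (Fin 3) ℚ) f
  rw [hf, div_eq_div_iff ((map_ne_zero_iff _ injective).2 (nonZeroDivisors.coe_ne_zero _))
    ((map_ne_zero_iff _ injective).2 hd), ← hf] at num_div_den
  exact injective (by rw [map_mul, map_mul, num_div_den])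

theorem RatFun.regularAt_div (hd : aeval x d ≠ 0) :
    RatFun.RegularAt (algebraMap _ RatFun n / algebraMap _ RatFun d) x := by
  have hd0 : d ≠ 0 := by
    rintro rfl
    exact hd (map_zero _)
  obtain ⟨e, d_eq⟩ := (IsFractionRing.num_den_reduced (MvPolynomial (Fin 3) ℚ)
    (algebraMap _ RatFun n / algebraMap _ RatFun d)).symm.dvd_of_dvd_mul_left
      (Dvd.intro_left n (RatFun.num_mul_eq_mul_den hd0 rfl).symm)
  rw [d_eq, map_mul] at hd
  exact left_ne_zero_of_mul hd

theorem RatFun.value_div (hd : aeval x d ≠ 0) :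
    RatFun.value (algebraMap _ RatFun n / algebraMap _ RatFun d) x = aeval x n / aeval x d := by
  have hd0 : d ≠ 0 := by
    rintro rfl
    exact hd (map_zero _)
  refine (div_eq_div_iff (RatFun.regularAt_div hd) hd).2 ?_
  rw [← map_mul, RatFun.num_mul_eq_mul_den hd0 rfl, map_mul]

/-- The evaluation of elements of `ℚ[x₁, x₂, x₃][w]` at a point of `ℂ³` and a value of `w`. -/
def evalHom (x : Fin 3 → ℂ) (w : ℂ) : Polynomial (MvPolynomial (Fin 3) ℚ) →+* ℂ :=
  Polynomial.eval₂RingHom (aeval x : MvPolynomial (Fin 3) ℚ →ₐ[ℚ] ℂ).toRingHom w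

theorem evalHom_C (x : Fin 3 → ℂ) (w : ℂ) (p : MvPolynomial (Fin 3) ℚ) :
    evalHom x w (Polynomial.C p) = aeval x p :=
  Polynomial.eval₂_C _ _

theorem evalHom_X (x : Fin 3 → ℂ) (w : ℂ) : evalHom x w Polynomial.X = w :=
  Polynomial.eval₂_X _ _

/-- The polynomial `Q / d` in `ℚ(x₁, x₂, x₃)[w]`. -/
def fracPolynomial (Q : Polynomial (MvPolynomial (Fin 3) ℚ)) (d : MvPolynomial (Fin 3) ℚ) :
    Polynomial RatFun :=
  Polynomial.C (algebraMap _ RatFun d)⁻¹ * Q.map (algebraMap _ RatFun)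

theorem natDegree_fracPolynomial_le (Q : Polynomial (MvPolynomial (Fin 3) ℚ))
    (d : MvPolynomial (Fin 3) ℚ) : (fracPolynomial Q d).natDegree ≤ Q.natDegree :=
  (Polynomial.natDegree_C_mul_le _ _).trans Polynomial.natDegree_map_le

theorem coeff_fracPolynomial (Q : Polynomial (MvPolynomial (Fin 3) ℚ))
    (d : MvPolynomial (Fin 3) ℚ) (k : ℕ) : (fracPolynomial Q d).coeff k =
      algebraMap _ RatFun (Q.coeff k) / algebraMap _ RatFun d := by
  rw [fracPolynomial, Polynomial.coeff_C_mul, Polynomial.coeff_map, div_eq_inv_mul]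

theorem polyValue_fracPolynomial (Q : Polynomial (MvPolynomial (Fin 3) ℚ))
    (hd : aeval x d ≠ 0) (w : ℂ) :
    polyValue (fracPolynomial Q d) w x = evalHom x w Q / aeval x d := by
  have value_coeff (k) :
      RatFun.value ((fracPolynomial Q d).coeff k) x = aeval x (Q.coeff k) / aeval x d := by
    rw [coeff_fracPolynomial, RatFun.value_div hd]
  have value_zero : RatFun.value 0 x = 0 := by
    simpa only [map_zero, zero_div] using RatFun.value_div (n := 0) hd
  rw [polyValue, Polynomial.sum_over_range' _ (fun k => by rw [value_zero, zero_mul]) _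
    (Nat.lt_succ_of_le (natDegree_fracPolynomial_le Q d)), evalHom, Polynomial.coe_eval₂RingHom,
    Polynomial.eval₂_eq_sum_range, Finset.sum_div]
  refine Finset.sum_congr rfl fun k _ => ?_
  rw [value_coeff, div_mul_eq_mul_div]
  rfl

end RatFun

section ThreeTermExponent

open Complex
open scoped Matrix

/-- `P` is an exponent in the three-term relation for the triple `v` at the point `x`. The factors
are indexed cyclically, `v (k + 1), v (k + 2)` being the wedge opposite to `v k`. -/
def IsThreeTermExponent (v : Fin 3 → Fin 3 → ℤ) (x : Fin 3 → ℂ) (P : ℂ → ℂ) : Prop :=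
  ∀ w, (∀ k, w ∉ zerosPoles (v (k + 1)) (v (k + 2)) x) →
    ∏ k, Gam (v (k + 1)) (v (k + 2)) w x = exp (-(Real.pi * I / 3) * P w)

variable {v : Fin 3 → Fin 3 → ℤ} {x : Fin 3 → ℂ}

theorem map_bernoulliThree {R S : Type*} [CommRing R] [CommRing S] [Algebra ℚ R] [Algebra ℚ S]
    (φ : R →+* S) (o : Fin 3 → R) (z : R) :
    φ (bernoulliThree o z) = bernoulliThree (fun k => φ (o k)) (φ z) := by
  simp only [bernoulliThree, map_add, map_mul, map_pow, RingHom.map_rat_algebraMap, map_ofNat]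

open Polynomial in
theorem natDegree_bernoulliThree_le {R : Type*} [CommRing R] [Algebra ℚ R] (o : Fin 3 → R)
    (z : R) : (bernoulliThree (fun k => C (o k)) (X - C z)).natDegree ≤ 3 := by
  simp only [bernoulliThree, IsScalarTower.algebraMap_apply ℚ R R[X], Polynomial.algebraMap_eq,
    ← C_ofNat, ← C_mul, ← C_add, ← C_pow]
  compute_degree

/-- The linear polynomial in `ℚ[x₁, x₂, x₃]` with the coefficients of an integral form. -/
def linPoly (δ : Fin 3 → ℤ) : MvPolynomial (Fin 3) ℚ :=
  ∑ i, MvPolynomial.C (δ i : ℚ) * MvPolynomial.X i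

theorem aeval_linPoly (δ : Fin 3 → ℤ) (x : Fin 3 → ℂ) :
    MvPolynomial.aeval x (linPoly δ) = formEval δ x := by
  simp [linPoly, formEval]

/-- The numerator of the exponent in the three-term relation for a positively oriented triple. -/
def exponentNum (v : Fin 3 → Fin 3 → ℤ) [Fintype (dualBox v (dualFrame v))] :
    Polynomial (MvPolynomial (Fin 3) ℚ) :=
  ∑ δ : dualBox v (dualFrame v), Polynomial.C 6 * bernoulliThree
    (fun k => Polynomial.C (linPoly (dualFrame v k))) (Polynomial.X - Polynomial.C (linPoly δ.1))

/-- The denominator of the exponent in the three-term relation for a positively oriented triple. -/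
def exponentDen (v : Fin 3 → Fin 3 → ℤ) : MvPolynomial (Fin 3) ℚ :=
  ∏ k, linPoly (dualFrame v k)

theorem natDegree_exponentNum_le (v : Fin 3 → Fin 3 → ℤ) [Fintype (dualBox v (dualFrame v))] :
    (exponentNum v).natDegree ≤ 3 :=
  Polynomial.natDegree_sum_le_of_forall_le _ _ fun _ _ =>
    (Polynomial.natDegree_C_mul_le _ _).trans (natDegree_bernoulliThree_le _ _)

theorem evalHom_exponentNum [Fintype (dualBox v (dualFrame v))] (w : ℂ) :
    evalHom x w (exponentNum v) = 6 * ∑ δ : dualBox v (dualFrame v),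
      bernoulliThree (frameValue v x) (w - formEval δ.1 x) := by
  simp only [exponentNum, map_sum, map_mul, map_bernoulliThree, map_sub, evalHom_C, evalHom_X,
    aeval_linPoly, map_ofNat, Finset.mul_sum]
  rfl

theorem aeval_exponentDen (v : Fin 3 → Fin 3 → ℤ) (x : Fin 3 → ℂ) :
    MvPolynomial.aeval x (exponentDen v) = ∏ k, frameValue v x k := by
  simp only [exponentDen, map_prod, aeval_linPoly, frameValue]

theorem isThreeTermExponent_of_det_pos [Fintype (dualBox v (dualFrame v))]
    (hv : 0 < (Matrix.of v).det) (hw : ∀ k, 0 < weight (v k) x) :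
    IsThreeTermExponent v x fun w =>
      evalHom x w (exponentNum v) / MvPolynomial.aeval x (exponentDen v) := by
  intro w hzeros
  have residue_eq (z) := originResidue_fin_three (pairIndep_frameValue hv hw).ne_zero z
  simp only [prod_Gam_eq_exp hv hw hzeros, evalHom_exponentNum, aeval_exponentDen, residue_eq,
    ← Finset.sum_div]
  congr 1
  ring

theorem isThreeTermExponent_of_det_eq_zero (hprim : ∀ k, IsPrimitive (v k))
    (hv : (Matrix.of v).det = 0) (hw : ∀ k, 0 < weight (v k) x) :
    IsThreeTermExponent v x 0 := by
  intro w hzeros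
  rw [Fin.prod_univ_three, Pi.zero_apply, mul_zero, exp_zero]
  exact Gam_three_term_of_coplanar (hprim _) (hprim _) (hprim _) (hw _) (hw _) (hw _)
    ((cross_dotProduct_eq_det v 0).trans hv) (hzeros 0) (hzeros 1) (hzeros 2)

theorem det_comp_neg (v : Fin 3 → Fin 3 → ℤ) :
    (Matrix.of fun k => v (-k)).det = -(Matrix.of v).det := by
  have sign_neg : Equiv.Perm.sign (Equiv.neg (Fin 3)) = -1 := by decide
  refine (Matrix.det_permute (Equiv.neg (Fin 3)) (Matrix.of v)).trans ?_
  rw [sign_neg, Units.val_neg, Units.val_one, Int.cast_neg, Int.cast_one, neg_one_mul]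

theorem IsThreeTermExponent.of_comp_neg {P : ℂ → ℂ} (hcross : ∀ k, v (k + 1) ⨯₃ v (k + 2) ≠ 0)
    (h : IsThreeTermExponent (fun k => v (-k)) x P) : IsThreeTermExponent v x (-P) := by
  have neg_add_one : ∀ k : Fin 3, -(k + 1) = -k + 2 := by decide
  have neg_add_two : ∀ k : Fin 3, -(k + 2) = -k + 1 := by decide
  intro w hzeros
  have prod_eq := h w fun k => by
    simpa only [neg_add_one, neg_add_two, zerosPoles_swap] using hzeros (-k)
  simp only [neg_add_one, neg_add_two, fun k => Gam_swap (hcross k) w x] at prod_eq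
  have prod_neg : ∏ k, (Gam (v (-k + 1)) (v (-k + 2)) w x)⁻¹ =
      ∏ k, (Gam (v (k + 1)) (v (k + 2)) w x)⁻¹ :=
    Equiv.prod_comp (Equiv.neg (Fin 3)) fun k => (Gam (v (k + 1)) (v (k + 2)) w x)⁻¹
  rw [prod_neg, Finset.prod_inv_distrib] at prod_eq
  rw [Pi.neg_apply, mul_neg, exp_neg, ← prod_eq, inv_inv]

theorem exists_isThreeTermExponent_of_det_pos (hv : 0 < (Matrix.of v).det) :
    ∃ (Q : Polynomial (MvPolynomial (Fin 3) ℚ)) (d : MvPolynomial (Fin 3) ℚ), Q.natDegree ≤ 3 ∧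
      ∀ x, (∀ k, 0 < weight (v k) x) → MvPolynomial.aeval x d ≠ 0 ∧
        IsThreeTermExponent v x fun w => evalHom x w Q / MvPolynomial.aeval x d := by
  have := (isDualFrame_dualFrame hv).finite_dualBox.fintype
  refine ⟨exponentNum v, exponentDen v, natDegree_exponentNum_le v, fun x hw =>
    ⟨?_, isThreeTermExponent_of_det_pos hv hw⟩⟩
  rw [aeval_exponentDen]
  exact Finset.prod_ne_zero_iff.2 fun k _ => (pairIndep_frameValue hv hw).ne_zero k

theorem exists_isThreeTermExponent (hprim : ∀ k, IsPrimitive (v k)) :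
    ∃ (Q : Polynomial (MvPolynomial (Fin 3) ℚ)) (d : MvPolynomial (Fin 3) ℚ), Q.natDegree ≤ 3 ∧
      ∀ x, (∀ k, 0 < weight (v k) x) → MvPolynomial.aeval x d ≠ 0 ∧
        IsThreeTermExponent v x fun w => evalHom x w Q / MvPolynomial.aeval x d := by
  rcases lt_trichotomy 0 (Matrix.of v).det with hv | hv | hv
  · exact exists_isThreeTermExponent_of_det_pos hv
  · refine ⟨0, 1, by simp, fun x hw => ⟨by simp, ?_⟩⟩
    simpa only [map_zero, zero_div] using! isThreeTermExponent_of_det_eq_zero hprim hv.symm hw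
  · obtain ⟨Q, d, natDegree_le, hQ⟩ := exists_isThreeTermExponent_of_det_pos
      (v := fun k => v (-k)) (by rwa [det_comp_neg, neg_pos])
    refine ⟨-Q, d, by rwa [Polynomial.natDegree_neg], fun x hw => ?_⟩
    obtain ⟨aeval_ne_zero, exponent⟩ := hQ x fun k => hw (-k)
    refine ⟨aeval_ne_zero, ?_⟩
    simpa only [map_neg, neg_div] using!
      exponent.of_comp_neg (cross_ne_zero_of_det_ne_zero hv.ne)

theorem exists_polyValue_isThreeTermExponent (hprim : ∀ k, IsPrimitive (v k)) :
    ∃ P : Polynomial RatFun, P.degree ≤ 3 ∧ ∀ x, (∀ k, 0 < weight (v k) x) →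
      (∀ k, RatFun.RegularAt (P.coeff k) x) ∧ IsThreeTermExponent v x fun w => polyValue P w x := by
  obtain ⟨Q, d, natDegree_le, hQ⟩ := exists_isThreeTermExponent hprim
  refine ⟨fracPolynomial Q d, Polynomial.natDegree_le_iff_degree_le.1
    ((natDegree_fracPolynomial_le Q d).trans natDegree_le), fun x hw => ?_⟩
  obtain ⟨aeval_ne_zero, exponent⟩ := hQ x hw
  refine ⟨fun k => ?_, ?_⟩
  · rw [coeff_fracPolynomial]
    exact RatFun.regularAt_div aeval_ne_zero
  · simpa only [polyValue_fracPolynomial Q aeval_ne_zero] using exponent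

end ThreeTermExponent

end GammaWedge

end

theorem mainTheorem2 :
    (∀ a b : Fin 3 → ℤ, GammaWedge.IsPrimitive a → GammaWedge.IsPrimitive b →
      ∀ x ∈ GammaWedge.UPlus a ∩ GammaWedge.UPlus b,
        (∀ w : ℂ, Multipliable (GammaWedge.numFactor a b w x) ∧
          Multipliable (GammaWedge.denFactor a b w x)) ∧
        Meromorphic (fun w : ℂ => GammaWedge.Gam a b w x) ∧
        (GammaWedge.zerosPoles a b x)ᶜ ∈ Filter.codiscrete ℂ ∧
        ∀ w : ℂ, w ∉ GammaWedge.zerosPoles a b x →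
          GammaWedge.Gam a b w x * GammaWedge.Gam b a w x = 1) ∧
    (∀ a b c : Fin 3 → ℤ, GammaWedge.IsPrimitive a → GammaWedge.IsPrimitive b →
      GammaWedge.IsPrimitive c →
      ∃ P : Polynomial GammaWedge.RatFun, P.degree ≤ 3 ∧
        ∀ x ∈ GammaWedge.UPlus a ∩ GammaWedge.UPlus b ∩ GammaWedge.UPlus c,
          (∀ k : ℕ, GammaWedge.RatFun.RegularAt (P.coeff k) x) ∧
          ∀ w : ℂ, w ∉ GammaWedge.zerosPoles a b x ∪ GammaWedge.zerosPoles b c x ∪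
              GammaWedge.zerosPoles c a x →
            GammaWedge.Gam a b w x * GammaWedge.Gam b c w x * GammaWedge.Gam c a w x =
              Complex.exp (-(Real.pi * Complex.I / 3) * GammaWedge.polyValue P w x)) := by
  refine ⟨fun a b hpa hpb x hx => ?_, fun a b c hpa hpb hpc => ?_⟩
  · have ha := GammaWedge.weight_pos hpa.ne_zero hx.1
    have hb := GammaWedge.weight_pos hpb.ne_zero hx.2
    exact ⟨GammaWedge.multipliable_numFactor_and_denFactor hpa hpb ha hb,
      GammaWedge.meromorphic_Gam hpa hpb ha hb,
      GammaWedge.compl_zerosPoles_mem_codiscrete hpa hpb ha hb,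
      fun w => GammaWedge.Gam_mul_Gam_swap hpa hpb ha hb⟩
  · obtain ⟨P, degree_le, hP⟩ := GammaWedge.exists_polyValue_isThreeTermExponent (v := ![c, a, b])
      (by simp [Fin.forall_fin_succ, hpa, hpb, hpc])
    refine ⟨P, degree_le, fun x ⟨⟨hxa, hxb⟩, hxc⟩ => ?_⟩
    obtain ⟨regularAt, exponent⟩ := hP x (by
      simp [Fin.forall_fin_succ, GammaWedge.weight_pos hpa.ne_zero hxa,
        GammaWedge.weight_pos hpb.ne_zero hxb, GammaWedge.weight_pos hpc.ne_zero hxc])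
    refine ⟨regularAt, fun w hw => ?_⟩
    simp only [Set.mem_union, not_or] at hw
    have prod_eq := exponent w (by simp [Fin.forall_fin_succ, hw])
    rwa [Fin.prod_univ_three] at prod_eq
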